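/- **Lemma 3.1.** Let $K$ be a cyclic cubic number field of conductor $p$ (that is, $p$ is the least positive integer with $K\subset\mathbb{Q}(\zeta_p)$), let $d$ be a squarefree positive integer, $k=\mathbb{Q}(\sqrt{-d})$, and let $F=K(\sqrt{-d})$. Write $\Delta_F$ and $\Delta_k$ for the discriminants and $O_F$, $O_K$ for the rings of integers, and put $t=\gcd(p,d)$. Let $\delta=\sqrt{-d}$ if $d\equiv 1,2 \pmod 4$ and $\delta=\frac{1+\sqrt{-d}}{2}$ if $d\equiv 3\pmod 4$. Then $$\Delta_F=\frac{p^4\,\Delta_k^3}{t^2},$$ and the index of additive groups satisfies $$[O_F:O_K[\delta]]=t.$$ -/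

import Mathlib

/-- `p` is the conductor of the (abelian) number field `K`: the least positive integer `n` such that
`K` embeds into the `n`-th cyclotomic field `ℚ(ζ_n)`. -/
def IsFieldConductor (K : Type*) [Field K] [NumberField K] (p : ℕ) : Prop :=
  IsLeast {n : ℕ | 0 < n ∧ Nonempty (K →ₐ[ℚ] CyclotomicField n ℚ)} p

/-- For a square root `s` of `-d`, the element `(1 + s) / 2` if `d ≡ 3 mod 4`, and `s` otherwise. -/
noncomputable def quadDelta {F : Type*} [Field F] (d : ℕ) (s : F) : F :=
  if d % 4 = 3 then (1 + s) / 2 else s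

theorem isIntegral_quadDelta {F : Type*} [Field F] [NumberField F] {d : ℕ} {s : F}
    (hs : s ^ 2 = -(d : F)) : IsIntegral ℤ (quadDelta d s) := by
  unfold quadDelta
  split_ifs with h
  · obtain ⟨m, rfl⟩ : ∃ m, d = 4 * m + 3 := ⟨d / 4, by omega⟩
    refine ⟨Polynomial.X ^ 2 + (-Polynomial.X + Polynomial.C (m + 1 : ℤ)), ?_, ?_⟩
    · apply Polynomial.monic_X_pow_add
      compute_degree!
    · push_cast at hs
      simp
      linear_combination (1 / 4) * hs
  · refine ⟨Polynomial.X ^ 2 + Polynomial.C (d : ℤ), ?_, ?_⟩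
    · exact Polynomial.monic_X_pow_add_C _ two_ne_zero
    · simp [hs]

/-- The element `quadDelta d s` in the ring of integers of `F`. -/
noncomputable def intDelta {F : Type*} [Field F] [NumberField F] (d : ℕ) (s : F)
    (hs : s ^ 2 = -(d : F)) : NumberField.RingOfIntegers F :=
  ⟨quadDelta d s, isIntegral_quadDelta hs⟩

section Auxiliary

open NumberField Module
open scoped nonZeroDivisors

/-! Write `δ² = τδ - n` with integers `τ, n`. Since `1, δ` is a basis of `F/K`, the order `O_K[δ]`
has discriminant `Δ_K² (τ² - 4n)³`, and this equals `Δ_F` times the square of the index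
(`discr_mul_index_sq`). It remains to compute the index, `Δ_K` and `Δ_k`.

Index: the `δ`-coordinates of integers of `F` form a fractional ideal of `K`. Every prime `q ∣ p` is
totally ramified in `K`, so `t O_K = I³` with `I` squarefree, and `d O_K = I³M` with `IM` squarefree
because `d/t` is prime to `Δ_K`. Trace and norm bound the coordinates, up to a factor `2` removed by
a parity argument, by the condition that `b²d` is integral, which forces `b ∈ I⁻¹`; conversely each
`b ∈ I⁻¹` is realised by an explicit integer. Hence the index is `[I⁻¹ : O_K] = N(I) = t`
(`index_adjoin_intDelta`). The same argument over `ℚ` with `I = (1)` gives `Δ_k = τ² - 4n`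
(`discr_adjoin_eq`).

Discriminant of `K`: `Δ_K = p²` (`discr_eq_sq_of_conductor`) is proved prime by prime. Minimality of
`p` gives nontrivial inertia at each `q ∣ p`, hence total ramification. The cubic discriminant of an
element of `P` outside `P²` then yields the exponent of `q` in `√Δ_K`, while the structure of
`(ℤ/p)ˣ` yields its exponent in `p`. Both are `1` for `q ≠ 3` and `2` for `q = 3`. -/

theorem mem_adjoin_singleton_iff_of_sq_eq {A B : Type*} [CommRing A] [CommRing B] [Algebra A B]
    {δ : B} {τ n : A} (hδ : δ ^ 2 = algebraMap A B τ * δ - algebraMap A B n) {x : B} :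
    x ∈ Algebra.adjoin A {δ} ↔ ∃ a b : A, x = algebraMap A B a + algebraMap A B b * δ := by
  constructor
  · intro hx
    induction hx using Algebra.adjoin_induction with
    | mem x hx =>
      obtain rfl := Set.mem_singleton_iff.mp hx
      exact ⟨0, 1, by simp⟩
    | algebraMap r => exact ⟨r, 0, by simp⟩
    | add x y _ _ hx hy =>
      obtain ⟨a, b, rfl⟩ := hx
      obtain ⟨a', b', rfl⟩ := hy
      exact ⟨a + a', b + b', by simp only [map_add]; ring⟩
    | mul x y _ _ hx hy =>
      obtain ⟨a, b, rfl⟩ := hx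
      obtain ⟨a', b', rfl⟩ := hy
      refine ⟨a * a' - b * b' * n, a * b' + b * a' + b * b' * τ, ?_⟩
      simp only [map_add, map_sub, map_mul]
      linear_combination (algebraMap A B b * algebraMap A B b') * hδ
  · rintro ⟨a, b, rfl⟩
    exact add_mem (Subalgebra.algebraMap_mem _ a)
      (mul_mem (Subalgebra.algebraMap_mem _ b) (Algebra.self_mem_adjoin_singleton A δ))

/-! ### Coordinates, trace and discriminant for a basis `1, δ`. -/

section QuadraticBasis

variable {K F : Type*} [Field K] [Field F] [Algebra K F] {c : Basis (Fin 2) K F} {δ : F}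

theorem eq_add_mul_of_basis (h0 : c 0 = 1) (h1 : c 1 = δ) (x : F) :
    x = algebraMap K F (c.repr x 0) + algebraMap K F (c.repr x 1) * δ := by
  conv_lhs => rw [← c.sum_repr x]
  simp [Fin.sum_univ_two, h0, h1, Algebra.smul_def]

theorem repr_add_mul (h0 : c 0 = 1) (h1 : c 1 = δ) (a b : K) :
    c.repr (algebraMap K F a + algebraMap K F b * δ) 0 = a ∧
    c.repr (algebraMap K F a + algebraMap K F b * δ) 1 = b := by
  have : algebraMap K F a + algebraMap K F b * δ = a • c 0 + b • c 1 := by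
    simp [h0, h1, Algebra.smul_def]
  rw [this]
  simp

theorem trace_add_mul (h0 : c 0 = 1) (h1 : c 1 = δ) {τ n : K}
    (hδ : δ ^ 2 = algebraMap K F τ * δ - algebraMap K F n) (a b : K) :
    Algebra.trace K F (algebraMap K F a + algebraMap K F b * δ) = 2 * a + b * τ := by
  rw [Algebra.trace_eq_matrix_trace c, Matrix.trace_fin_two, Algebra.leftMulMatrix_eq_repr_mul,
    Algebra.leftMulMatrix_eq_repr_mul, h0, h1, mul_one, (repr_add_mul h0 h1 a b).1]
  have : (algebraMap K F a + algebraMap K F b * δ) * δ =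
      algebraMap K F (- b * n) + algebraMap K F (a + b * τ) * δ := by
    simp only [map_add, map_mul, map_neg]
    linear_combination (algebraMap K F b) * hδ
  rw [this, (repr_add_mul h0 h1 _ _).2]
  ring

/-- The relative traces of `1, δ, δ²` lie in `k`, so the trace matrix of the product basis is a
Kronecker product with the 2×2 matrix `T`, whose determinant is `τ² - 4n`. -/
theorem discr_smulTower_of_sq_eq {k : Type*} [Field k] [Algebra k K] [Algebra k F]
    [IsScalarTower k K F] {ι : Type*} [Fintype ι] [DecidableEq ι] (b : Basis ι k K)
    (h0 : c 0 = 1) (h1 : c 1 = δ) {τ n : k}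
    (hδ : δ ^ 2 = algebraMap k F τ * δ - algebraMap k F n) :
    Algebra.discr k (b.smulTower c) =
      Algebra.discr k b ^ 2 * (τ ^ 2 - 4 * n) ^ Fintype.card ι := by
  have : FiniteDimensional k K := b.finiteDimensional_of_finite
  have : FiniteDimensional K F := c.finiteDimensional_of_finite
  have hδ' : δ ^ 2 = algebraMap K F (algebraMap k K τ) * δ - algebraMap K F (algebraMap k K n) := by
    simpa only [← IsScalarTower.algebraMap_apply] using hδ
  let T : Matrix (Fin 2) (Fin 2) k := !![2, τ; τ, τ ^ 2 - 2 * n]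
  have hT : ∀ i j, Algebra.trace K F (c i * c j) = algebraMap k K (T i j) := by
    have e := trace_add_mul h0 h1 hδ'
    have e00 := e 1 0
    have e01 := e 0 1
    have e11 := e (-(algebraMap k K n)) (algebraMap k K τ)
    simp only [map_one, map_zero, zero_mul, add_zero, zero_add, one_mul, mul_one, mul_zero]
      at e00 e01
    have h11 : δ * δ = algebraMap K F (-(algebraMap k K n)) + algebraMap K F (algebraMap k K τ) * δ := by
      rw [map_neg]; linear_combination hδ'
    intro i j
    fin_cases i <;> fin_cases j
    · simp [h0, T, e00, map_ofNat (algebraMap k K) 2]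
    · simp [h0, h1, T, e01]
    · simp [h0, h1, T, e01]
    · have h2 : algebraMap k K 2 = 2 := map_ofNat _ 2
      simp only [Fin.mk_one, h1, T, Matrix.of_apply, Matrix.cons_val_one, Matrix.cons_val_fin_one,
        map_sub, map_mul, map_pow, h2]
      rw [h11, e11]; ring
  have hM : Algebra.traceMatrix k (b.smulTower c) =
      Matrix.kroneckerMap (· * ·) (Algebra.traceMatrix k b) T := by
    ext ⟨i, i'⟩ ⟨j, j'⟩
    simp only [Algebra.traceMatrix_apply, Algebra.traceForm_apply, Matrix.kroneckerMap_apply,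
      Basis.smulTower_apply]
    rw [← Algebra.trace_trace (S := K), smul_mul_smul_comm, map_smul, hT, smul_eq_mul, mul_comm,
      ← Algebra.smul_def, map_smul, smul_eq_mul, mul_comm]
  rw [Algebra.discr_def, hM, Matrix.det_kronecker, Fintype.card_fin, Matrix.det_fin_two_of,
    ← Algebra.discr_def]
  ring

end QuadraticBasis

/-! ### The order `O_K[δ]` and its discriminant. -/

section Order

variable {K F : Type*} [Field K] [NumberField K] [Field F] [NumberField F] [Algebra K F]
  {c : Basis (Fin 2) K F} {δ : 𝓞 F} {τ n : ℤ}

omit [NumberField K] [NumberField F] in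
-- Only the `δ`-coordinate `b` needs testing: once it is integral, the other coordinate `x - bδ` is
-- integral too.
theorem mem_adjoin_ringOfIntegers_iff (h0 : c 0 = 1) (h1 : c 1 = δ)
    (hδ : (δ : F) ^ 2 = τ * (δ : F) - n) {x : 𝓞 F} :
    x ∈ Algebra.adjoin (𝓞 K) {δ} ↔ ∃ b : 𝓞 K, c.repr x 1 = b := by
  have hδ' : δ ^ 2 = algebraMap (𝓞 K) (𝓞 F) τ * δ - algebraMap (𝓞 K) (𝓞 F) n := by
    ext; simpa using hδ
  rw [mem_adjoin_singleton_iff_of_sq_eq hδ']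
  constructor
  · rintro ⟨a, b, rfl⟩
    refine ⟨b, ?_⟩
    have := (repr_add_mul h0 h1 (a : K) (b : K)).2
    exact this
  · rintro ⟨b, hb⟩
    have hx := eq_add_mul_of_basis h0 h1 (x : F)
    rw [hb] at hx
    have ha : IsIntegral ℤ (c.repr x 0) := by
      have h2 : IsIntegral ℤ (algebraMap K F (c.repr x 0)) := by
        have : algebraMap K F (c.repr x 0) = ((x - algebraMap (𝓞 K) (𝓞 F) b * δ : 𝓞 F) : F) := by
          exact eq_sub_of_add_eq hx.symm
        rw [this]
        exact RingOfIntegers.isIntegral_coe _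
      exact (isIntegral_algebraMap_iff (algebraMap K F).injective).mp h2
    refine ⟨⟨_, ha⟩, b, ?_⟩
    ext
    exact hx

/-- The products of an integral basis of `K` with `1, δ` form a `ℤ`-basis of `O_K[δ]`. The
base-change determinant to an integral basis of `F` is the index up to sign, and its square is the
ratio of discriminants. -/
theorem discr_mul_index_sq (h0 : c 0 = 1) (h1 : c 1 = δ)
    (hδ : (δ : F) ^ 2 = τ * (δ : F) - n) :
    discr F * ((Algebra.adjoin (𝓞 K) {δ}).toSubring.toAddSubgroup.index : ℤ) ^ 2 =
      discr K ^ 2 * (τ ^ 2 - 4 * n) ^ finrank ℚ K := by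
  classical
  let B := (integralBasis K).smulTower c
  let e := (integralBasis F).indexEquiv B
  let b₂ := (integralBasis F).reindex e
  have hB : ∀ x : F, x ∈ Submodule.span ℤ (Set.range B) ↔
      ∃ y ∈ Algebra.adjoin (𝓞 K) {δ}, algebraMap (𝓞 F) F y = x := by
    have hrepr : ∀ y : K, (∀ i, (integralBasis K).repr y i ∈ Set.range (algebraMap ℤ ℚ)) ↔
        ∃ a : 𝓞 K, y = a := fun y ↦ by
      rw [← Basis.mem_span_iff_repr_mem, mem_span_integralBasis]
      simp [eq_comm]
    intro x
    rw [Basis.mem_span_iff_repr_mem]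
    simp only [Prod.forall, B, Basis.smulTower_repr_mk, Fin.forall_fin_two, forall_and, hrepr]
    constructor
    · rintro ⟨⟨a, ha⟩, b, hb⟩
      have hx : ((algebraMap (𝓞 K) (𝓞 F) a + algebraMap (𝓞 K) (𝓞 F) b * δ : 𝓞 F) : F) = x := by
        rw [eq_add_mul_of_basis h0 h1 x, ha, hb]
        rfl
      exact ⟨_, (mem_adjoin_ringOfIntegers_iff h0 h1 hδ).mpr ⟨b, by rw [hx, hb]⟩, hx⟩
    · rintro ⟨y, hy, rfl⟩
      have hδ' : δ ^ 2 = algebraMap (𝓞 K) (𝓞 F) τ * δ - algebraMap (𝓞 K) (𝓞 F) n := by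
        ext; simpa using hδ
      obtain ⟨a, b, rfl⟩ := (mem_adjoin_singleton_iff_of_sq_eq hδ').mp hy
      exact ⟨⟨a, (repr_add_mul h0 h1 (a : K) (b : K)).1⟩, b, (repr_add_mul h0 h1 (a : K) (b : K)).2⟩
  have hidx : ((Algebra.adjoin (𝓞 K) {δ}).toSubring.toAddSubgroup.index : ℚ) = |b₂.det B| := by
    rw [← AddSubgroup.relIndex_eq_abs_det
      ((Algebra.adjoin (𝓞 K) {δ}).toSubring.toAddSubgroup.map (algebraMap (𝓞 F) F).toAddMonoidHom)
      ((⊤ : AddSubgroup (𝓞 F)).map (algebraMap (𝓞 F) F).toAddMonoidHom)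
      (AddSubgroup.map_mono le_top) B b₂, AddSubgroup.relIndex_map_map_of_injective,
      AddSubgroup.relIndex_top_right]
    · exact RingOfIntegers.coe_injective
    · apply AddSubgroup.toIntSubmodule.injective
      rw [AddSubgroup.toIntSubmodule_closure]
      ext x
      rw [hB]
      exact Iff.rfl
    · apply AddSubgroup.toIntSubmodule.injective
      rw [AddSubgroup.toIntSubmodule_closure, Basis.range_reindex]
      ext x
      rw [mem_span_integralBasis]
      exact ⟨fun ⟨y, _, h⟩ ↦ ⟨y, h⟩, fun ⟨y, h⟩ ↦ ⟨y, trivial, h⟩⟩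
  have hd : Algebra.discr ℚ B = (b₂.det B) ^ 2 * discr F := by
    rw [coe_discr, ← Algebra.discr_reindex ℚ (integralBasis F) e, ← Basis.coe_reindex,
      Basis.det_apply, ← Algebra.discr_of_matrix_vecMul, Basis.toMatrix_map_vecMul]
  have hδ' : (δ : F) ^ 2 = algebraMap ℚ F τ * δ - algebraMap ℚ F n := by simpa using hδ
  rw [discr_smulTower_of_sq_eq _ h0 h1 hδ', ← coe_discr, ← finrank_eq_card_basis (integralBasis K)]
    at hd
  have : (discr F : ℚ) * ((Algebra.adjoin (𝓞 K) {δ}).toSubring.toAddSubgroup.index : ℚ) ^ 2 =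
      discr K ^ 2 * (τ ^ 2 - 4 * n) ^ finrank ℚ K := by
    rw [hidx, sq_abs, hd, mul_comm]
  exact_mod_cast this

end Order

/-! ### The index as the norm of an ideal. -/

section Index

variable {K F : Type*} [Field K] [NumberField K] [Field F] [NumberField F] [Algebra K F]
  {c : Basis (Fin 2) K F} {δ : 𝓞 F} {τ n : ℤ}

omit [NumberField F] in
-- Hypothesis `h` says that the `δ`-coordinate map `φ` sends `𝓞 F` onto `I⁻¹`. As `O_K[δ]` is the
-- preimage of `O_K`, the quotient is `I⁻¹/O_K ≅ O_K/I`.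
theorem index_adjoin_eq_absNorm (h0 : c 0 = 1) (h1 : c 1 = δ)
    (hδ : (δ : F) ^ 2 = τ * (δ : F) - n) {I : Ideal (𝓞 K)} (hI : I ≠ ⊥)
    (h : ∀ b : K, (∃ x : 𝓞 F, c.repr x 1 = b) ↔ ∀ y ∈ I, IsIntegral ℤ (b * y)) :
    (Algebra.adjoin (𝓞 K) {δ}).toSubring.toAddSubgroup.index = Ideal.absNorm I := by
  let φ : 𝓞 F →+ K := (((c.coord 1).restrictScalars ℤ).toAddMonoidHom).comp
    (algebraMap (𝓞 F) F).toAddMonoidHom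
  have hcomap : (Algebra.adjoin (𝓞 K) {δ}).toSubring.toAddSubgroup =
      ((1 : FractionalIdeal (𝓞 K)⁰ K) : Submodule (𝓞 K) K).toAddSubgroup.comap φ := by
    ext x
    refine (mem_adjoin_ringOfIntegers_iff h0 h1 hδ).trans ?_
    simp only [AddSubgroup.mem_comap, Submodule.mem_toAddSubgroup, FractionalIdeal.mem_coe,
      FractionalIdeal.mem_one_iff]
    exact ⟨fun ⟨b, hb⟩ ↦ ⟨b, hb.symm⟩, fun ⟨b, hb⟩ ↦ ⟨b, hb.symm⟩⟩
  have hI' : (I : FractionalIdeal (𝓞 K)⁰ K) ≠ 0 := by simpa using hI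
  have hrange : φ.range = ((I : FractionalIdeal (𝓞 K)⁰ K)⁻¹ : FractionalIdeal (𝓞 K)⁰ K).coeToSubmodule.toAddSubgroup := by
    ext b
    rw [Submodule.mem_toAddSubgroup, FractionalIdeal.mem_coe, FractionalIdeal.mem_inv_iff hI']
    refine (h b).trans ⟨fun H y hy ↦ ?_, fun H y hy ↦ ?_⟩
    · obtain ⟨y, hyI, rfl⟩ := (FractionalIdeal.mem_coeIdeal _).mp hy
      exact (FractionalIdeal.mem_one_iff _).mpr ⟨⟨_, H y hyI⟩, rfl⟩
    · obtain ⟨z, hz⟩ := (FractionalIdeal.mem_one_iff _).mp (H y (FractionalIdeal.mem_coeIdeal_of_mem _ hy))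
      exact hz ▸ RingOfIntegers.isIntegral_coe z
  rw [hcomap, AddSubgroup.index_comap, hrange]
  have := FractionalIdeal.quotientEquiv (R := 𝓞 K) (K := K) 1 I (I : FractionalIdeal (𝓞 K)⁰ K)⁻¹ 1
    (by simp [hI]) FractionalIdeal.coeIdeal_le_one
    (le_inv_of_le_inv₀ (by simp [pos_iff_ne_zero, hI])
      (by simpa using FractionalIdeal.coeIdeal_le_one)) one_ne_zero one_ne_zero
  refine (Nat.card_congr this.toEquiv).symm.trans ?_
  have hnorm : Ideal.absNorm I = (IsLocalization.coeSubmodule K I).toAddSubgroup.relIndex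
      ((⊤ : AddSubgroup (𝓞 K)).map (algebraMap (𝓞 K) K).toAddMonoidHom) := by
    refine I.toAddSubgroup.relIndex_top_right.symm.trans ?_
    rw [← Submodule.comap_map_eq_of_injective (f := Algebra.linearMap (𝓞 K) K)
      (FaithfulSMul.algebraMap_injective (𝓞 K) K) I]
    refine (AddSubgroup.relIndex_comap (IsLocalization.coeSubmodule K I).toAddSubgroup
      (algebraMap (𝓞 K) K).toAddMonoidHom ⊤).trans ?_
    rw [IsLocalization.coeSubmodule, Submodule.comap_map_eq_of_injective
      (FaithfulSMul.algebraMap_injective (𝓞 K) K) I]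
    rfl
  have htop : (⊤ : AddSubgroup (𝓞 K)).map (algebraMap (𝓞 K) K).toAddMonoidHom =
      ((1 : FractionalIdeal (𝓞 K)⁰ K) : Submodule (𝓞 K) K).toAddSubgroup := by
    ext x
    rw [Submodule.mem_toAddSubgroup, FractionalIdeal.mem_coe, FractionalIdeal.mem_one_iff]
    exact ⟨fun ⟨y, _, h⟩ ↦ ⟨y, h⟩, fun ⟨y, h⟩ ↦ ⟨y, trivial, h⟩⟩
  rw [hnorm, htop]
  rfl

end Index

theorem isIntegral_int_natCast {A : Type*} [CommRing A] (m : ℕ) : IsIntegral ℤ (m : A) :=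
  map_natCast (algebraMap ℤ A) m ▸ isIntegral_algebraMap

theorem isIntegral_of_sq_eq {K F : Type*} [Field K] [Field F] [Algebra K F] {T N : K}
    (hT : IsIntegral ℤ T) (hN : IsIntegral ℤ N) {x : F}
    (hx : x ^ 2 = algebraMap K F T * x - algebraMap K F N) : IsIntegral ℤ x := by
  refine isIntegral_trans (A := 𝓞 K) x ?_
  let T' : 𝓞 K := ⟨T, hT⟩
  let N' : 𝓞 K := ⟨N, hN⟩
  refine ⟨Polynomial.X ^ 2 + (-(Polynomial.C T' * Polynomial.X) + Polynomial.C N'), ?_, ?_⟩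
  · apply Polynomial.monic_X_pow_add
    compute_degree!
  · rw [Polynomial.eval₂_add, Polynomial.eval₂_add, Polynomial.eval₂_neg, Polynomial.eval₂_pow,
      Polynomial.eval₂_mul, Polynomial.eval₂_C, Polynomial.eval₂_C, Polynomial.eval₂_X]
    have e1 : algebraMap (𝓞 K) F T' = algebraMap K F T := rfl
    have e2 : algebraMap (𝓞 K) F N' = algebraMap K F N := rfl
    rw [e1, e2, hx]
    ring

/-- The parity argument showing that `ℤ[√-d]` needs no denominator `2` when `d ≡ 1, 2 mod 4`, valid
wherever `2` behaves as a squarefree element. For `d ≡ 1` one passes to `x + y`, whose square is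
even; for `d ≡ 2`, `x` itself is even. -/
theorem two_dvd_of_sq_add_mul_sq {R : Type*} [CommRing R] [IsDomain R] [CharZero R]
    (h2 : ∀ x : R, 2 ∣ x ^ 2 → 2 ∣ x) {d : ℕ} (hd : d % 4 = 1 ∨ d % 4 = 2) {x y : R}
    (h : 4 ∣ x ^ 2 + d * y ^ 2) : 2 ∣ y := by
  have two_ne : (2 : R) ≠ 0 := two_ne_zero
  obtain ⟨z, hz⟩ := h
  apply h2
  rcases hd with hd | hd
  · obtain ⟨k, rfl⟩ : ∃ k, d = 4 * k + 1 := ⟨d / 4, by omega⟩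
    push_cast at hz
    obtain ⟨w, hw⟩ := h2 (x + y) ⟨2 * z + x * y - 2 * k * y ^ 2, by linear_combination hz⟩
    obtain rfl : x = 2 * w - y := by linear_combination hw
    refine ⟨z - w ^ 2 + w * y - k * y ^ 2, mul_left_cancel₀ two_ne ?_⟩
    linear_combination hz
  · obtain ⟨k, rfl⟩ : ∃ k, d = 4 * k + 2 := ⟨d / 4, by omega⟩
    push_cast at hz
    obtain ⟨w, rfl⟩ := h2 x ⟨2 * z - (2 * k + 1) * y ^ 2, by linear_combination hz⟩
    refine ⟨z - w ^ 2 - k * y ^ 2, mul_left_cancel₀ two_ne ?_⟩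
    linear_combination hz

/-! ### Which `δ`-coordinates occur among the integers of `F`. -/

section QuadDelta

variable {K F : Type*} [Field K] [NumberField K] [Field F] [NumberField F] [Algebra K F]
  {c : Basis (Fin 2) K F} {d : ℕ} {s : F} {I : Ideal (𝓞 K)} {t : ℕ}

theorem quadDelta_sq (hs : s ^ 2 = -(d : F)) : ∃ τ n : ℤ,
    quadDelta d s ^ 2 = τ * quadDelta d s - n := by
  rw [quadDelta]
  split_ifs with h
  · obtain ⟨m, rfl⟩ : ∃ m, d = 4 * m + 3 := ⟨d / 4, by omega⟩
    refine ⟨1, m + 1, ?_⟩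
    push_cast at hs ⊢
    linear_combination hs / 4
  · exact ⟨0, d, by simp [hs]⟩

omit [NumberField K] [NumberField F] in
theorem isIntegral_norm_form {δ : F} (h0 : c 0 = 1) (h1 : c 1 = δ) {τ n : K}
    (hδ : δ ^ 2 = algebraMap K F τ * δ - algebraMap K F n) {a b : K}
    (hx : IsIntegral ℤ (algebraMap K F a + algebraMap K F b * δ)) :
    IsIntegral ℤ (2 * a + b * τ) ∧ IsIntegral ℤ (a ^ 2 + a * b * τ + b ^ 2 * n) := by
  have : FiniteDimensional K F := c.finiteDimensional_of_finite
  have hT : IsIntegral ℤ (2 * a + b * τ) := by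
    rw [← trace_add_mul h0 h1 hδ a b]
    exact Algebra.isIntegral_trace hx
  refine ⟨hT, (isIntegral_algebraMap_iff (algebraMap K F).injective).mp ?_⟩
  have : algebraMap K F (a ^ 2 + a * b * τ + b ^ 2 * n) =
      algebraMap K F (2 * a + b * τ) * (algebraMap K F a + algebraMap K F b * δ) -
        (algebraMap K F a + algebraMap K F b * δ) ^ 2 := by
    simp only [map_add, map_mul, map_pow, map_ofNat]
    linear_combination (algebraMap K F b) ^ 2 * hδ
  rw [this]
  exact (hT.algebraMap.mul hx).sub (hx.pow 2)

theorem isIntegral_mul_of_isIntegral_repr (h0 : c 0 = 1) (h1 : c 1 = quadDelta d s)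
    (hs : s ^ 2 = -(d : F)) (hd : Squarefree d)
    (h2 : d % 4 ≠ 3 → ∀ x : 𝓞 K, 2 ∣ x ^ 2 → 2 ∣ x)
    (hI : ∀ b : K, IsIntegral ℤ (b ^ 2 * d) → ∀ y ∈ I, IsIntegral ℤ (b * y))
    (htI : (t : 𝓞 K) ∈ I) (ht : Odd t) {x : F} (hx : IsIntegral ℤ x) :
    ∀ y ∈ I, IsIntegral ℤ (c.repr x 1 * y) := by
  have hs' : s ^ 2 = -algebraMap K F d := by simpa using hs
  set a := c.repr x 0
  set b := c.repr x 1
  have hxab : x = algebraMap K F a + algebraMap K F b * quadDelta d s :=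
    eq_add_mul_of_basis h0 h1 x
  rw [hxab] at hx
  by_cases hd4 : d % 4 = 3
  · have hδ : quadDelta d s ^ 2 = algebraMap K F 1 * quadDelta d s - algebraMap K F ((1 + d) / 4) := by
      rw [quadDelta, if_pos hd4]
      simp only [map_div₀, map_add, map_one, map_ofNat]
      linear_combination hs' / 4
    obtain ⟨hT, hN⟩ := isIntegral_norm_form h0 h1 hδ hx
    apply hI
    -- Four times the norm minus the square of the trace.
    have : b ^ 2 * d = 4 * (a ^ 2 + a * b * 1 + b ^ 2 * ((1 + d) / 4)) - (2 * a + b * 1) ^ 2 := by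
      ring
    rw [this]
    exact ((isIntegral_int_natCast 4).mul hN).sub (hT.pow 2)
  · have hδ : quadDelta d s ^ 2 = algebraMap K F 0 * quadDelta d s - algebraMap K F d := by
      rw [quadDelta, if_neg hd4, hs']
      simp
    obtain ⟨hT, hN⟩ := isIntegral_norm_form h0 h1 hδ hx
    simp only [mul_zero, add_zero] at hT hN
    have hb : ∀ y ∈ I, IsIntegral ℤ (2 * b * y) := by
      apply hI
      have : (2 * b) ^ 2 * d = 4 * (a ^ 2 + b ^ 2 * d) - (2 * a) ^ 2 := by ring
      rw [this]
      exact ((isIntegral_int_natCast 4).mul hN).sub (hT.pow 2)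
    have ht' : IsIntegral ℤ (t : K) := isIntegral_int_natCast t
    have hd4' : d % 4 = 1 ∨ d % 4 = 2 := by
      have : d % 4 ≠ 0 := fun h ↦ by
        have := Nat.isUnit_iff.mp (hd 2 (Nat.dvd_of_mod_eq_zero h))
        omega
      omega
    obtain ⟨A, hA⟩ : ∃ A : 𝓞 K, (A : K) = 2 * a := ⟨⟨_, hT⟩, rfl⟩
    obtain ⟨B, hB⟩ : ∃ B : 𝓞 K, (B : K) = 2 * b * t := ⟨⟨_, hb t htI⟩, rfl⟩
    obtain ⟨C, hC⟩ : ∃ C : 𝓞 K, (C : K) = a ^ 2 + b ^ 2 * d := ⟨⟨_, hN⟩, rfl⟩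
    -- Scaling by `t ∈ I` makes `2b` an element of `O_K`, so the parity lemma applies; as `t` is
    -- odd, the factor `2` is then removed from `2by` using `t = 2k + 1`.
    obtain ⟨w, rfl⟩ := two_dvd_of_sq_add_mul_sq (h2 hd4) hd4' (x := t * A) (y := B) ⟨t ^ 2 * C, by
      ext
      simp only [map_add, map_mul, map_pow, map_natCast, map_ofNat, hA, hB, hC]
      ring⟩
    have htb : IsIntegral ℤ (t * b) := by
      rw [RingOfIntegers.coe_eq_algebraMap, map_mul, map_ofNat] at hB
      have : t * b = w := mul_left_cancel₀ (two_ne_zero (α := K)) (by linear_combination -hB)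
      exact this ▸ RingOfIntegers.isIntegral_coe w
    intro y hy
    obtain ⟨k, hk⟩ := ht
    have hy' : IsIntegral ℤ (y : K) := RingOfIntegers.isIntegral_coe y
    have : b * y = t * b * y - k * (2 * b * y) := by rw [hk]; push_cast; ring
    rw [this]
    exact (htb.mul hy').sub ((isIntegral_int_natCast k).mul (hb y hy))

omit [NumberField K] in
-- For `b ∈ I⁻¹` both `bt` and `b²t` are integral, since `t ∈ I³ ⊆ I²`. The element realising `b` is
-- `b(t + s)/2` if `d ≡ 3 mod 4`, and `bs` otherwise.
theorem exists_isIntegral_repr_eq (h0 : c 0 = 1) (h1 : c 1 = quadDelta d s)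
    (hs : s ^ 2 = -(d : F)) (hIt : I ^ 3 = Ideal.span {(t : 𝓞 K)}) (ht : Odd t) (htd : t ∣ d)
    {b : K} (hb : ∀ y ∈ I, IsIntegral ℤ (b * y)) : ∃ x : F, IsIntegral ℤ x ∧ c.repr x 1 = b := by
  have hs' : s ^ 2 = -algebraMap K F d := by simpa using hs
  have ht3 : (t : 𝓞 K) ∈ I ^ 3 := hIt ▸ Ideal.mem_span_singleton_self _
  have hbt : IsIntegral ℤ (b * t) := hb t (Ideal.pow_le_self three_ne_zero ht3)
  have hbbt : IsIntegral ℤ (b ^ 2 * t) := by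
    have : ∀ z ∈ I * I, IsIntegral ℤ (b ^ 2 * z) := by
      intro z hz
      induction hz using Submodule.mul_induction_on' with
      | mem_mul_mem u hu v hv =>
        have : b ^ 2 * ((u * v : 𝓞 K) : K) = (b * u) * (b * v) := by
          rw [RingOfIntegers.coe_eq_algebraMap, map_mul]; ring
        rw [this]
        exact (hb u hu).mul (hb v hv)
      | add u _ v _ hu hv =>
        rw [RingOfIntegers.coe_eq_algebraMap, map_add, mul_add]
        exact hu.add hv
    refine this t ?_
    rw [← sq]
    exact Ideal.pow_le_pow_right (by norm_num) ht3
  obtain ⟨m, rfl⟩ := htd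
  by_cases hd4 : t * m % 4 = 3
  · obtain ⟨k, hk⟩ := ht
    -- With `d = tm`, the norm of `b(t + s)/2` is `b²t(t + m)/4`, and `tm ≡ 3 mod 4` forces `t ≡ -m
    -- mod 4`.
    have h4 : 4 ∣ t + m := by
      have ht4 : t % 4 = 1 ∨ t % 4 = 3 := by omega
      have hm4 : m % 4 < 4 := Nat.mod_lt _ (by norm_num)
      rw [Nat.mul_mod] at hd4
      rcases ht4 with h | h <;> rw [h] at hd4 <;> interval_cases h' : m % 4 <;> omega
    obtain ⟨l, hl⟩ := h4
    refine ⟨algebraMap K F (b * k) + algebraMap K F b * quadDelta (t * m) s, ?_,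
      (repr_add_mul h0 h1 _ _).2⟩
    refine isIntegral_of_sq_eq hbt (N := b ^ 2 * t * l)
      (hbbt.mul (isIntegral_int_natCast l)) ?_
    rw [quadDelta, if_pos hd4]
    have hl' : (t : F) + m = 4 * l := by exact_mod_cast hl
    have hk' : (t : F) = 2 * k + 1 := by exact_mod_cast hk
    simp only [map_mul, map_pow, map_natCast]
    push_cast at hs
    have hk2 : (k : F) = (t - 1) / 2 := by rw [hk']; ring
    rw [hk2]
    linear_combination (algebraMap K F b) ^ 2 / 4 * hs - (algebraMap K F b) ^ 2 * t / 4 * hl'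
  · refine ⟨algebraMap K F 0 + algebraMap K F b * quadDelta (t * m) s, ?_,
      (repr_add_mul h0 h1 _ _).2⟩
    refine isIntegral_of_sq_eq (T := 0) isIntegral_zero (N := b ^ 2 * t * m)
      (hbbt.mul (isIntegral_int_natCast m)) ?_
    rw [quadDelta, if_neg hd4]
    push_cast at hs
    simp only [map_mul, map_pow, map_natCast, map_zero, zero_mul, zero_add, zero_sub, mul_pow, hs]
    ring

theorem index_adjoin_intDelta (h0 : c 0 = 1) (h1 : c 1 = quadDelta d s)
    (hs : s ^ 2 = -(d : F)) (hd : Squarefree d)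
    (h2 : d % 4 ≠ 3 → ∀ x : 𝓞 K, 2 ∣ x ^ 2 → 2 ∣ x)
    (hI : ∀ b : K, IsIntegral ℤ (b ^ 2 * d) → ∀ y ∈ I, IsIntegral ℤ (b * y))
    (hIt : I ^ 3 = Ideal.span {(t : 𝓞 K)}) (ht : Odd t) (htd : t ∣ d) :
    (Algebra.adjoin (𝓞 K) {intDelta d s hs}).toSubring.toAddSubgroup.index = Ideal.absNorm I := by
  have htI : (t : 𝓞 K) ∈ I :=
    Ideal.pow_le_self three_ne_zero (hIt ▸ Ideal.mem_span_singleton_self _)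
  have hI0 : I ≠ ⊥ := by
    rintro rfl
    have : t = 0 := by exact_mod_cast (Ideal.mem_bot.mp htI)
    simp [this] at ht
  obtain ⟨τ, n, hτn⟩ := quadDelta_sq hs
  refine index_adjoin_eq_absNorm h0 h1 hτn hI0 fun b ↦ ⟨?_, fun hb ↦ ?_⟩
  · rintro ⟨x, rfl⟩
    exact isIntegral_mul_of_isIntegral_repr h0 h1 hs hd h2 hI htI ht (RingOfIntegers.isIntegral_coe x)
  · obtain ⟨x, hx, hxb⟩ := exists_isIntegral_repr_eq h0 h1 hs hIt ht htd hb
    exact ⟨⟨x, hx⟩, hxb⟩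

theorem exists_basis_quadDelta (hs : s ^ 2 = -(d : F)) (hF : IntermediateField.adjoin K {s} = ⊤)
    (hsK : s ∉ Set.range (algebraMap K F)) :
    ∃ c : Basis (Fin 2) K F, c 0 = 1 ∧ c 1 = quadDelta d s := by
  obtain ⟨u, v, hv, hδ⟩ : ∃ u v : K, v ≠ 0 ∧ quadDelta d s = algebraMap K F u + algebraMap K F v * s := by
    rw [quadDelta]
    split_ifs
    · exact ⟨1 / 2, 1 / 2, by norm_num, by simp only [map_div₀, map_one, map_ofNat]; ring⟩
    · exact ⟨0, 1, one_ne_zero, by simp⟩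
  have hli : LinearIndependent K ![1, quadDelta d s] := by
    rw [LinearIndependent.pair_iff]
    intro a b hab
    rw [hδ, Algebra.smul_def, Algebra.smul_def] at hab
    have hb : b = 0 := by
      by_contra hb
      refine hsK ⟨-(a + b * u) / (b * v), ?_⟩
      have h1 : algebraMap K F b ≠ 0 := by simpa using hb
      have h2 : algebraMap K F v ≠ 0 := by simpa using hv
      simp only [map_div₀, map_neg, map_add, map_mul]
      field_simp
      linear_combination -hab
    refine ⟨?_, hb⟩
    simpa [hb] using hab
  have hspan : ⊤ ≤ Submodule.span K (Set.range ![1, quadDelta d s]) := by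
    intro x _
    have hx : x ∈ Algebra.adjoin K {s} := by
      have halg : IsAlgebraic K s := Algebra.IsAlgebraic.isAlgebraic s
      have := IntermediateField.adjoin_simple_toSubalgebra_of_isAlgebraic halg
      rw [hF] at this
      rw [← this]
      trivial
    have hs0 : s ^ 2 = algebraMap K F 0 * s - algebraMap K F d := by simp [hs]
    obtain ⟨a, b, rfl⟩ := (mem_adjoin_singleton_iff_of_sq_eq hs0).mp hx
    rw [Matrix.range_cons, Matrix.range_cons, Matrix.range_empty, Set.union_empty,
      Set.singleton_union, Submodule.mem_span_pair]
    refine ⟨a - b / v * u, b / v, ?_⟩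
    have h2 : algebraMap K F v ≠ 0 := by simpa using hv
    rw [hδ, Algebra.smul_def, Algebra.smul_def]
    simp only [map_div₀, map_sub, map_mul]
    field_simp
    ring
  exact ⟨Basis.mk hli hspan, by simp, by simp⟩

end QuadDelta

theorem not_coprime_of_natCast_mem {R : Type*} [CommRing R] {P : Ideal R} (hP : P ≠ ⊤) {a b : ℕ}
    (ha : (a : R) ∈ P) (hb : (b : R) ∈ P) : ¬ a.Coprime b := fun h ↦ by
  obtain ⟨u, v, huv⟩ := Nat.isCoprime_iff_coprime.mpr h
  refine hP ((Ideal.eq_top_iff_one P).mpr ?_)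
  have : (u * a + v * b : R) = 1 := by exact_mod_cast congrArg (Int.cast : ℤ → R) huv
  rw [← this]
  exact add_mem (P.mul_mem_left _ ha) (P.mul_mem_left _ hb)

/-! ### Ramification, the discriminant and squarefree ideals. -/

section Squarefree

variable {K : Type*} [Field K] [NumberField K]

/-- A ramified `P` divides the different, whose norm is `|Δ_K|`; and `q` divides the norm of `P`. -/
theorem dvd_discr_of_sq_dvd {q : ℕ} (hq : q.Prime) {P : Ideal (𝓞 K)} (hP : Prime P)
    (h : P ^ 2 ∣ Ideal.span {(q : 𝓞 K)}) : (q : ℤ) ∣ discr K := by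
  have : Fact q.Prime := ⟨hq⟩
  have hmax : (Ideal.span {(q : ℤ)}).IsMaximal := Int.ideal_span_isMaximal_of_prime q
  have hD : P ^ (2 - 1) ∣ differentIdeal ℤ (𝓞 K) := by
    refine pow_sub_one_dvd_differentIdeal_aux ℤ ℚ K (p := Ideal.span {(q : ℤ)}) P two_ne_zero
      (by simpa using hq.ne_zero) ?_
    simpa [Ideal.map_span] using h
  rw [show 2 - 1 = 1 from rfl, pow_one] at hD
  have hN := map_dvd Ideal.absNorm hD
  rw [absNorm_differentIdeal K] at hN
  have hqP : (q : 𝓞 K) ∈ P := by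
    rw [← Ideal.span_singleton_le_iff_mem, ← Ideal.dvd_iff_le]
    exact (dvd_pow_self P two_ne_zero).trans h
  have hqN : q ∣ Ideal.absNorm P := by
    by_contra hcop
    exact not_coprime_of_natCast_mem (Ideal.isPrime_of_prime hP).ne_top hqP (Ideal.absNorm_mem P)
      ((Nat.Prime.coprime_iff_not_dvd hq).mpr hcop)
  exact Int.natCast_dvd.mpr (hqN.trans hN)

theorem squarefree_span_natCast {m : ℕ} (hm : Squarefree m)
    (hK : IsCoprime (m : ℤ) (discr K)) : Squarefree (Ideal.span {(m : 𝓞 K)}) := by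
  have hm0 : Ideal.span {(m : 𝓞 K)} ≠ 0 := by simpa using hm.ne_zero
  rw [squarefree_iff_irreducible_sq_not_dvd_of_ne_zero hm0]
  intro P hP hPm
  rw [← sq] at hPm
  have hP := hP.prime
  have hPrime := Ideal.isPrime_of_prime hP
  have hmP : (m : 𝓞 K) ∈ P := by
    rw [← Ideal.span_singleton_le_iff_mem, ← Ideal.dvd_iff_le]
    exact (dvd_pow_self P two_ne_zero).trans hPm
  obtain ⟨q, hq, hqm, hqP⟩ : ∃ q : ℕ, q.Prime ∧ q ∣ m ∧ (q : 𝓞 K) ∈ P := by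
    rw [← Nat.prod_primeFactors_of_squarefree hm, Nat.cast_prod, hPrime.prod_mem_iff] at hmP
    obtain ⟨q, hq, hqP⟩ := hmP
    exact ⟨q, Nat.prime_of_mem_primeFactors hq, Nat.dvd_of_mem_primeFactors hq, hqP⟩
  obtain ⟨m', rfl⟩ := hqm
  have hm'P : ¬ P ∣ Ideal.span {(m' : 𝓞 K)} := fun h ↦
    not_coprime_of_natCast_mem hPrime.ne_top hqP
      ((Ideal.span_singleton_le_iff_mem _).mp (Ideal.dvd_iff_le.mp h))
      (Nat.coprime_of_squarefree_mul hm)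
  rw [Nat.cast_mul, ← Ideal.span_singleton_mul_span_singleton] at hPm
  have hqK := dvd_discr_of_sq_dvd hq hP (hP.pow_dvd_of_dvd_mul_right 2 hm'P hPm)
  have := hK.isUnit_of_dvd' (Int.natCast_dvd_natCast.mpr (dvd_mul_right q m')) hqK
  exact hq.one_lt.ne' (by simpa using Int.natAbs_of_isUnit this)

theorem two_dvd_of_two_dvd_sq (h2 : IsCoprime 2 (discr K)) (x : 𝓞 K) (hx : 2 ∣ x ^ 2) : 2 ∣ x := by
  have := squarefree_span_natCast (K := K) Nat.prime_two.squarefree (by exact_mod_cast h2)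
  rw [← Ideal.span_singleton_le_span_singleton, ← Ideal.dvd_iff_le] at hx ⊢
  rw [← Ideal.span_singleton_pow] at hx
  exact (this.dvd_pow_iff_dvd two_ne_zero).mp (by exact_mod_cast hx)

/-- After cancelling the gcd, the square of the remaining factor of `a` divides `s`, so that factor
is a unit. -/
theorem dvd_of_sq_dvd_sq_mul_of_squarefree {α : Type*} [CommMonoidWithZero α] [NormalizedGCDMonoid α]
    {a c s : α} (hs : Squarefree s) (ha : a ≠ 0)
    (h : a ^ 2 ∣ c ^ 2 * s) : a ∣ c := by
  obtain ⟨a', c', h1, h2, hu⟩ := extract_gcd a c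
  have hg : gcd a c ≠ 0 := fun h ↦ ha (by rw [h1, h, zero_mul])
  have h3 : gcd a c ^ 2 * a' ^ 2 ∣ gcd a c ^ 2 * (c' ^ 2 * s) := by
    rwa [← mul_pow, ← h1, ← mul_assoc, ← mul_pow, ← h2]
  have h4 := (mul_dvd_mul_iff_left (pow_ne_zero 2 hg)).mp h3
  have hrel : IsRelPrime (a' ^ 2) (c' ^ 2) := (gcd_isUnit_iff_isRelPrime.mp hu).pow
  have h5 := hrel.dvd_of_dvd_mul_left h4
  rw [sq] at h5
  have hau : IsUnit a' := hs a' h5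
  rw [h1, hau.mul_right_dvd]
  exact gcd_dvd_right a c

/-- For `b = u/v`, integrality of `b²d` says `(v)² ∣ ((u)I)² · IM`. Since `IM` is squarefree, `(v) ∣
(u)I`. -/
theorem isIntegral_mul_of_isIntegral_sq_mul {I M : Ideal (𝓞 K)} {d : ℕ}
    (hdM : Ideal.span {(d : 𝓞 K)} = I ^ 3 * M) (hIM : Squarefree (I * M)) (b : K)
    (hb : IsIntegral ℤ (b ^ 2 * d)) : ∀ y ∈ I, IsIntegral ℤ (b * y) := by
  obtain ⟨u, v, hv, rfl⟩ := IsFractionRing.div_surjective (A := 𝓞 K) b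
  have hv0 : v ≠ 0 := nonZeroDivisors.ne_zero hv
  have hvK : algebraMap (𝓞 K) K v ≠ 0 := by simpa using hv0
  obtain ⟨w, hw⟩ : ∃ w : 𝓞 K, (w : K) = (algebraMap (𝓞 K) K u / algebraMap (𝓞 K) K v) ^ 2 * d :=
    ⟨⟨_, hb⟩, rfl⟩
  have huv : u ^ 2 * d = v ^ 2 * w := by
    ext
    rw [RingOfIntegers.coe_eq_algebraMap] at hw
    simp only [map_mul, map_pow, map_natCast, hw]
    field_simp
  have hdvd : Ideal.span {v} ^ 2 ∣ (Ideal.span {u} * I) ^ 2 * (I * M) := by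
    rw [show (Ideal.span {u} * I) ^ 2 * (I * M) = Ideal.span {u} ^ 2 * (I ^ 3 * M) by ring, ← hdM,
      Ideal.span_singleton_pow, Ideal.span_singleton_pow, Ideal.span_singleton_mul_span_singleton,
      huv, ← Ideal.span_singleton_mul_span_singleton]
    exact dvd_mul_right _ _
  have := Ideal.dvd_iff_le.mp (dvd_of_sq_dvd_sq_mul_of_squarefree hIM (by simpa using hv0) hdvd)
  intro y hy
  obtain ⟨z, hz⟩ := Ideal.mem_span_singleton.mp
    (this (Ideal.mul_mem_mul (Ideal.mem_span_singleton_self u) hy))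
  have : algebraMap (𝓞 K) K u / algebraMap (𝓞 K) K v * y = z := by
    have := congrArg (algebraMap (𝓞 K) K) hz
    rw [map_mul, map_mul] at this
    field_simp
    linear_combination this
  exact this ▸ RingOfIntegers.isIntegral_coe z

end Squarefree

/-! ### The discriminant of `ℚ(√-d)`. -/

section

variable {F : Type*} [Field F] [NumberField F] {d : ℕ} {s : F}

/-- The index computation with base field `ℚ`, `I = ⊤` and `t = 1` gives index `1`. -/
theorem discr_adjoin_eq (hs : s ^ 2 = -(d : F)) (hd : Squarefree d) {τ n : ℤ}
    (hτn : quadDelta d s ^ 2 = τ * quadDelta d s - n) :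
    discr (IntermediateField.adjoin ℚ {s}) = τ ^ 2 - 4 * n := by
  let k := IntermediateField.adjoin ℚ {s}
  let s' : k := IntermediateField.AdjoinSimple.gen ℚ s
  have hs' : s' ^ 2 = -(d : k) := by
    apply (algebraMap k F).injective
    simpa [s'] using hs
  have hF' : IntermediateField.adjoin ℚ {s'} = ⊤ := by
    suffices @IntermediateField.adjoin ℚ _ k _ k.algebra' {s'} = ⊤ by
      convert this <;> exact Subsingleton.elim _ _
    apply IntermediateField.lift_injective k
    rw [IntermediateField.lift_adjoin_simple, IntermediateField.lift_top]
    rfl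
  have hsQ : s' ∉ Set.range (algebraMap ℚ k) := by
    rintro ⟨q, hq⟩
    have : (algebraMap ℚ k) (q ^ 2) = algebraMap ℚ k (-d) := by rw [map_pow, hq, hs']; simp
    have := (algebraMap ℚ k).injective this
    have hd0 : (0 : ℚ) < d := by exact_mod_cast Nat.pos_of_ne_zero hd.ne_zero
    nlinarith [sq_nonneg q]
  obtain ⟨c, h0, h1⟩ := exists_basis_quadDelta hs' hF' hsQ
  have hδ : intDelta d s' hs' = quadDelta d s' := rfl
  have hτn' : ((intDelta d s' hs' : 𝓞 k) : k) ^ 2 = τ * ((intDelta d s' hs' : 𝓞 k) : k) - n := by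
    apply (algebraMap k F).injective
    rw [hδ]
    have : algebraMap k F (quadDelta d s') = quadDelta d s := by
      rw [quadDelta, quadDelta]
      split_ifs
      · rw [map_div₀, map_add, map_one, map_ofNat]
        rfl
      · rfl
    simp only [map_pow, map_sub, map_mul, map_intCast, this, hτn]
  have hsq : Squarefree (Ideal.span {(d : 𝓞 ℚ)}) :=
    squarefree_span_natCast hd (by simpa using isCoprime_one_right)
  have hidx := index_adjoin_intDelta (I := ⊤) (t := 1) h0 h1 hs' hd
    (fun _ x ↦ two_dvd_of_two_dvd_sq (by simp) x)
    (isIntegral_mul_of_isIntegral_sq_mul (M := Ideal.span {(d : 𝓞 ℚ)}) (by simp [← Ideal.one_eq_top])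
      (by simpa [← Ideal.one_eq_top] using hsq))
    (by simp [← Ideal.one_eq_top]) odd_one (one_dvd _)
  have := discr_mul_index_sq h0 h1 hτn'
  rw [hidx] at this
  simpa using this

end

/-! ### Groups of order three. -/

section CardThree

variable {G : Type*} [Group G] {σ : G}

theorem orderOf_eq_three_of_card (hG : Nat.card G = 3) (hσ : σ ≠ 1) : orderOf σ = 3 :=
  haveI : Fact (Nat.Prime 3) := ⟨Nat.prime_three⟩
  orderOf_eq_prime (hG ▸ pow_card_eq_one') hσ

theorem univ_eq_of_card_eq_three [Fintype G] [DecidableEq G] (hG : Nat.card G = 3) (hσ : σ ≠ 1) :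
    (Finset.univ : Finset G) = {1, σ, σ ^ 2} := by
  symm
  apply Finset.eq_univ_of_card
  have h2 : σ ^ 2 ≠ 1 := fun h ↦ by
    have := orderOf_dvd_of_pow_eq_one h
    rw [orderOf_eq_three_of_card hG hσ] at this
    omega
  rw [← Nat.card_eq_fintype_card, hG, Finset.card_eq_three]
  refine ⟨1, σ, σ ^ 2, hσ.symm, h2.symm, fun h ↦ hσ ?_, rfl⟩
  rw [sq] at h
  exact mul_left_cancel (h.symm.trans (mul_one σ).symm)

end CardThree

/-! ### Cubic polynomials of elements of a Galois cubic field. -/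

section Cubic

variable {K : Type*} [Field K] [NumberField K] [IsGalois ℚ K]

theorem card_gal_eq_three (hK : finrank ℚ K = 3) : Nat.card Gal(K/ℚ) = 3 :=
  (IsGalois.card_aut_eq_finrank ℚ K).trans hK

variable {σ : Gal(K/ℚ)}

theorem coe_trace_eq_add_add (hK : finrank ℚ K = 3) (hσ : σ ≠ 1) (x : 𝓞 K) :
    ((Algebra.trace ℤ (𝓞 K) x : ℤ) : 𝓞 K) = x + σ • x + σ • σ • x := by
  classical
  ext
  have h := trace_eq_sum_automorphisms (K := ℚ) (x : K)
  rw [← Algebra.coe_trace_int, univ_eq_of_card_eq_three (card_gal_eq_three hK) hσ] at h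
  have h3 := orderOf_eq_three_of_card (card_gal_eq_three hK) hσ
  have h2 : σ ^ 2 ≠ 1 := fun h ↦ by
    have := orderOf_dvd_of_pow_eq_one h
    rw [h3] at this
    omega
  have h1 : σ ≠ σ ^ 2 := fun h ↦ hσ (by rw [sq] at h; exact mul_left_cancel (h.symm.trans (mul_one σ).symm))
  rw [Finset.sum_insert (by simp [hσ.symm, h2.symm]), Finset.sum_pair h1] at h
  simp only [map_intCast, map_add] at h ⊢
  rw [h, ← add_assoc]
  rfl

theorem exists_intCast_eq_of_smul_eq (hK : finrank ℚ K = 3) (hσ : σ ≠ 1) {x : 𝓞 K}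
    (hx : σ • x = x) : ∃ n : ℤ, (n : 𝓞 K) = x := by
  classical
  refine Algebra.IsInvariant.isInvariant (A := ℤ) (G := Gal(K/ℚ)) x fun τ ↦ ?_
  have hτ : τ ∈ ({1, σ, σ ^ 2} : Finset Gal(K/ℚ)) :=
    univ_eq_of_card_eq_three (card_gal_eq_three hK) hσ ▸ Finset.mem_univ τ
  simp only [Finset.mem_insert, Finset.mem_singleton] at hτ
  rcases hτ with rfl | rfl | rfl
  · exact one_smul _ x
  · exact hx
  · rw [sq, mul_smul, hx, hx]

/-- The elementary symmetric functions of the conjugates of `x`, together with the relation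
between the discriminant of `1, x, x ^ 2` and that of the field. -/
theorem exists_cubic_invariants (hK : finrank ℚ K = 3) (hσ : σ ≠ 1) (x : 𝓞 K) :
    ∃ a b c m j : ℤ, (a : 𝓞 K) = x + σ • x + σ • σ • x ∧
      (b : 𝓞 K) = x * σ • x + σ • x * σ • σ • x + σ • σ • x * x ∧
      (c : 𝓞 K) = x * σ • x * σ • σ • x ∧
      m ^ 2 = j ^ 2 * discr K ∧
      m ^ 2 = a ^ 2 * b ^ 2 - 4 * b ^ 3 - 4 * a ^ 3 * c - 27 * c ^ 2 + 18 * a * b * c := by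
  have h3 : σ • σ • σ • x = x := by
    have h := orderOf_eq_three_of_card (card_gal_eq_three hK) hσ
    rw [← mul_smul, ← mul_smul, ← sq, ← pow_succ, show 2 + 1 = orderOf σ from h.symm, pow_orderOf_eq_one, one_smul]
  obtain ⟨a, ha⟩ := exists_intCast_eq_of_smul_eq hK hσ (x := x + σ • x + σ • σ • x)
    (by simp only [smul_add, h3]; ring)
  obtain ⟨b, hb⟩ := exists_intCast_eq_of_smul_eq hK hσ
    (x := x * σ • x + σ • x * σ • σ • x + σ • σ • x * x)
    (by simp only [smul_add, smul_mul', h3]; ring)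
  obtain ⟨c, hc⟩ := exists_intCast_eq_of_smul_eq hK hσ (x := x * σ • x * σ • σ • x)
    (by simp only [smul_mul', h3]; ring)
  -- The product of differences of conjugates is invariant under the cyclic shift `σ`, hence an
  -- integer; this makes the discriminant a square.
  obtain ⟨m, hm⟩ := exists_intCast_eq_of_smul_eq hK hσ
    (x := (x - σ • x) * (σ • x - σ • σ • x) * (σ • σ • x - x))
    (by simp only [smul_mul', smul_sub, h3]; ring)
  let v : Fin 3 → 𝓞 K := fun i ↦ x ^ (i : ℕ)
  have hcard : Fintype.card (Free.ChooseBasisIndex ℤ (𝓞 K)) = 3 := by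
    rw [← finrank_eq_card_chooseBasisIndex, RingOfIntegers.rank, hK]
  let B : Basis (Fin 3) ℤ (𝓞 K) :=
    (RingOfIntegers.basis K).reindex (Fintype.equivFinOfCardEq hcard)
  have hdisc : Algebra.discr ℤ v = (B.toMatrix v).det ^ 2 * discr K := by
    rw [← discr_eq_discr K B, ← Algebra.discr_of_matrix_vecMul, Basis.toMatrix_map_vecMul]
  have htr : ∀ k : ℕ, ((Algebra.trace ℤ (𝓞 K) (x ^ k) : ℤ) : 𝓞 K) =
      x ^ k + (σ • x) ^ k + (σ • σ • x) ^ k := fun k ↦ by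
    rw [coe_trace_eq_add_add hK hσ, smul_pow', smul_pow']
  have hdisc' : ((Algebra.discr ℤ v : ℤ) : 𝓞 K) = (m : 𝓞 K) ^ 2 := by
    rw [Algebra.discr_def, Matrix.det_fin_three]
    simp only [Algebra.traceMatrix_apply, Algebra.traceForm_apply, v, ← pow_add]
    push_cast
    simp only [htr, hm]
    simp
    ring
  have hinj : Function.Injective (Int.cast : ℤ → 𝓞 K) := Int.cast_injective
  refine ⟨a, b, c, m, (B.toMatrix v).det, ha, hb, hc, ?_, ?_⟩
  · rw [← hdisc]
    apply hinj
    rw [hdisc', Int.cast_pow]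
  · apply hinj
    push_cast
    rw [ha, hb, hc, hm]
    ring

/-- Modulo `q³` only `-27c²` survives, and it is divisible by `q` exactly twice. -/
theorem not_pow_four_dvd_cubic_discr {q a b c : ℤ} (hq : Prime q) (hq3 : ¬ q ∣ 3) (ha : q ∣ a)
    (hb : q ∣ b) (hc : q ∣ c) (hc2 : ¬ q ^ 2 ∣ c) :
    ¬ q ^ 4 ∣ a ^ 2 * b ^ 2 - 4 * b ^ 3 - 4 * a ^ 3 * c - 27 * c ^ 2 + 18 * a * b * c := by
  obtain ⟨a, rfl⟩ := ha
  obtain ⟨b, rfl⟩ := hb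
  obtain ⟨c, rfl⟩ := hc
  rintro ⟨e, he⟩
  apply hc2
  rw [sq]
  refine mul_dvd_mul_left q ?_
  have h : q ∣ 3 ^ 3 * c ^ 2 := by
    refine ⟨a ^ 2 * b ^ 2 * q - 4 * b ^ 3 - 4 * a ^ 3 * c * q + 18 * a * b * c - q * e, ?_⟩
    refine mul_left_cancel₀ (pow_ne_zero 2 hq.ne_zero) ?_
    linear_combination -he
  rcases hq.dvd_or_dvd h with h | h
  · exact absurd (hq.dvd_of_dvd_pow h) hq3
  · exact hq.dvd_of_dvd_pow h

/-- Write `a, b, c` as `3a', 3b', 3c'`. Divisibility by `3⁶` would force `3 ∣ b'`, then `3 ∣ a'c'`,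
and in either case `3 ∣ c'`. -/
theorem not_three_pow_six_dvd_cubic_discr {a b c : ℤ} (ha : 3 ∣ a)
    (hb : 3 ∣ b) (hc : 3 ∣ c) (hc2 : ¬ 3 ^ 2 ∣ c) :
    ¬ 3 ^ 6 ∣ a ^ 2 * b ^ 2 - 4 * b ^ 3 - 4 * a ^ 3 * c - 27 * c ^ 2 + 18 * a * b * c := by
  have h3 : Prime (3 : ℤ) := Int.prime_three
  obtain ⟨a, rfl⟩ := ha
  obtain ⟨b, rfl⟩ := hb
  obtain ⟨c, rfl⟩ := hc
  rintro ⟨e, he⟩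
  apply hc2
  rw [sq]
  refine mul_dvd_mul_left 3 ?_
  obtain ⟨b, rfl⟩ : 3 ∣ b := by
    refine h3.dvd_of_dvd_pow (n := 3) ?_
    have : 3 ∣ 4 * b ^ 3 := ⟨a ^ 2 * b ^ 2 - 4 * a ^ 3 * c - 3 * c ^ 2 + 6 * a * b * c - 9 * e, by linarith⟩
    omega
  obtain ⟨a, rfl⟩ | h : 3 ∣ a ∨ 3 ∣ c := by
    have : 3 ∣ 4 * (a ^ 3 * c) := ⟨3 * a ^ 2 * b ^ 2 - 12 * b ^ 3 - c ^ 2 + 6 * a * b * c - 3 * e, by linarith⟩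
    have : 3 ∣ a ^ 3 * c := by omega
    exact (h3.dvd_or_dvd this).imp_left h3.dvd_of_dvd_pow
  · have : 3 ∣ c ^ 2 := ⟨9 * a ^ 2 * b ^ 2 - 4 * b ^ 3 - 12 * a ^ 3 * c + 6 * a * b * c - e, by linarith⟩
    exact h3.dvd_of_dvd_pow this
  · exact h

end Cubic

/-! ### Totally ramified primes and the exponents in `√Δ_K`. -/

section TotallyRamified

variable {K : Type*} [Field K] [NumberField K] {σ : Gal(K/ℚ)} {q : ℕ} {P : Ideal (𝓞 K)}

omit [NumberField K] in
theorem natCast_dvd_of_intCast_mem (hq : q.Prime) (hP : P ≠ ⊤) (hqP : (q : 𝓞 K) ∈ P) {n : ℤ}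
    (hn : (n : 𝓞 K) ∈ P) : (q : ℤ) ∣ n := by
  by_contra h
  have hnP : ((n.natAbs : ℕ) : 𝓞 K) ∈ P := by
    rcases n.natAbs_eq with h' | h' <;> rw [h'] at hn <;> simpa using hn
  exact not_coprime_of_natCast_mem hP hqP hnP
    ((Nat.Prime.coprime_iff_not_dvd hq).mpr fun h' ↦ h (Int.natCast_dvd.mpr h'))

variable [IsGalois ℚ K]

/-- A nontrivial inertia group in a group of order `3` is everything, so `e = 3`, and `efg = 3`
leaves a single prime above `q`. -/
theorem span_natCast_eq_pow_three (hK : finrank ℚ K = 3) (hσ : σ ≠ 1) (hq : q.Prime)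
    (hP : P.IsPrime) (hqP : (q : 𝓞 K) ∈ P) (hin : ∀ x : 𝓞 K, σ • x - x ∈ P) :
    Ideal.span {(q : 𝓞 K)} = P ^ 3 := by
  have : Fact q.Prime := ⟨hq⟩
  have : Fact (Nat.Prime 3) := ⟨Nat.prime_three⟩
  have hqZ : Prime (q : ℤ) := Nat.prime_iff_prime_int.mp hq
  have hmax : (Ideal.span {(q : ℤ)}).IsMaximal := Int.ideal_span_isMaximal_of_prime q
  have hlies : P.LiesOver (Ideal.span {(q : ℤ)}) :=
    (Ideal.liesOver_span_iff hP.ne_top hqZ).mpr (by exact_mod_cast hqP)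
  have hcard := card_gal_eq_three (K := K) hK
  have hinertia : Ideal.inertia Gal(K/ℚ) P = ⊤ := by
    rw [eq_top_iff]
    intro τ _
    have hτ := mem_zpowers_of_prime_card (p := 3) hcard hσ (g' := τ)
    exact (Subgroup.zpowers_le.mpr (AddSubgroup.mem_inertia.mpr hin)) hτ
  have he : (Ideal.span {(q : ℤ)}).ramificationIdxIn (𝓞 K) = 3 := by
    rw [← Ideal.card_inertia_eq_ramificationIdxIn (G := Gal(K/ℚ)) (Ideal.span {(q : ℤ)}) P, hinertia,
      Subgroup.card_top, hcard]
  have hncard := Ideal.ncard_primesOver_mul_ramificationIdxIn_mul_inertiaDegIn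
    (Ideal.span {(q : ℤ)}) (𝓞 K) Gal(K/ℚ)
  rw [he, hcard, mul_left_comm, Nat.mul_eq_left three_ne_zero] at hncard
  have hone := Nat.eq_one_of_mul_eq_one_right hncard
  have hmem : P ∈ (Ideal.span {(q : ℤ)}).primesOver (𝓞 K) := ⟨hP, hlies⟩
  obtain ⟨Q, hQ⟩ := Set.ncard_eq_one.mp hone
  obtain rfl : P = Q := by rwa [hQ] at hmem
  have hmap := Ideal.map_algebraMap_eq_finsetProd_pow (R := 𝓞 K) (p := Ideal.span {(q : ℤ)})
    (by simpa using hq.ne_zero)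
  have hfin : ((Ideal.span {(q : ℤ)}).primesOver (𝓞 K)).toFinset = {P} := by
    ext; simp [hQ]
  rw [hfin, Finset.prod_singleton,
    ← Ideal.ramificationIdxIn_eq_ramificationIdx (Ideal.span {(q : ℤ)}) P Gal(K/ℚ), he,
    Ideal.map_span] at hmap
  simpa using hmap

theorem exists_eisenstein_invariants (hK : finrank ℚ K = 3) (hσ : σ ≠ 1) (hq : q.Prime)
    (hP : P.IsPrime) (hPq : Ideal.span {(q : 𝓞 K)} = P ^ 3) (hin : ∀ x : 𝓞 K, σ • x - x ∈ P) :
    ∃ a b c m j : ℤ, (q : ℤ) ∣ a ∧ (q : ℤ) ∣ b ∧ (q : ℤ) ∣ c ∧ ¬ (q : ℤ) ^ 2 ∣ c ∧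
      m ^ 2 = j ^ 2 * discr K ∧
      m ^ 2 = a ^ 2 * b ^ 2 - 4 * b ^ 3 - 4 * a ^ 3 * c - 27 * c ^ 2 + 18 * a * b * c := by
  have hq3 : (q : 𝓞 K) ∈ P ^ 3 := hPq ▸ Ideal.mem_span_singleton_self _
  have hqP : (q : 𝓞 K) ∈ P := Ideal.pow_le_self three_ne_zero hq3
  have hP0 : P ≠ ⊥ := by
    rintro rfl
    exact hq.ne_zero (by exact_mod_cast Ideal.mem_bot.mp hqP)
  have hPrime : Prime P := Ideal.prime_of_isPrime hP0 hP
  obtain ⟨x, hxP, hxP2⟩ : ∃ x ∈ P, x ∉ P ^ 2 :=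
    SetLike.exists_of_lt (by simpa using Ideal.pow_right_strictAnti P hP0 hP.ne_top one_lt_two)
  obtain ⟨a, b, c, m, j, ha, hb, hc, hm, hm'⟩ := exists_cubic_invariants hK hσ x
  have hy : σ • x ∈ P := by simpa using add_mem (hin x) hxP
  have hz : σ • σ • x ∈ P := by simpa using add_mem (hin (σ • x)) hy
  have hqa : (q : ℤ) ∣ a := natCast_dvd_of_intCast_mem hq hP.ne_top hqP
    (ha ▸ add_mem (add_mem hxP hy) hz)
  have hqb : (q : ℤ) ∣ b := natCast_dvd_of_intCast_mem hq hP.ne_top hqP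
    (hb ▸ add_mem (add_mem (P.mul_mem_right _ hxP) (P.mul_mem_right _ hy)) (P.mul_mem_right _ hz))
  have hqc : (q : ℤ) ∣ c := natCast_dvd_of_intCast_mem hq hP.ne_top hqP
    (hc ▸ P.mul_mem_right _ (P.mul_mem_right _ hxP))
  refine ⟨a, b, c, m, j, hqa, hqb, hqc, ?_, hm, hm'⟩
  rintro ⟨c', rfl⟩
  obtain ⟨a, rfl⟩ := hqa
  obtain ⟨b, rfl⟩ := hqb
  -- If `q² ∣ c`, the cubic equation of `x` would put `x³` in `P³ · P`, although `x` lies in `P` but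
  -- not in `P²`.
  have hx4 : x ^ 3 ∈ P ^ 4 := by
    have : x ^ 3 = q * (x * (a * x - b) + q * c') := by
      push_cast at ha hb hc
      linear_combination -x ^ 2 * ha + x * hb - hc
    rw [this, pow_succ P 3]
    refine Ideal.mul_mem_mul hq3 (add_mem (P.mul_mem_right _ hxP) (P.mul_mem_right _ hqP))
  rw [← Ideal.span_singleton_le_iff_mem, ← Ideal.dvd_iff_le, ← Ideal.span_singleton_pow] at hx4
  obtain ⟨J, hJ⟩ : P ∣ Ideal.span {x} := Ideal.dvd_iff_le.mpr ((Ideal.span_singleton_le_iff_mem _).mpr hxP)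
  rw [hJ, mul_pow, pow_succ P 3, mul_dvd_mul_iff_left (pow_ne_zero 3 hP0)] at hx4
  have := mul_dvd_mul_left P (hPrime.dvd_of_dvd_pow hx4)
  rw [← hJ, ← sq, Ideal.dvd_iff_le, Ideal.span_singleton_le_iff_mem] at this
  exact hxP2 this

theorem pow_not_dvd_of_eisenstein (hK : finrank ℚ K = 3) (hσ : σ ≠ 1) (hq : q.Prime)
    (hP : P.IsPrime) (hPq : Ideal.span {(q : 𝓞 K)} = P ^ 3) (hin : ∀ x : 𝓞 K, σ • x - x ∈ P) :
    ∃ m j : ℤ, m ^ 2 = j ^ 2 * discr K ∧ m ≠ 0 ∧ (q ≠ 3 → ¬ (q : ℤ) ^ 4 ∣ m ^ 2) ∧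
      (q = 3 → ¬ (q : ℤ) ^ 6 ∣ m ^ 2) := by
  obtain ⟨a, b, c, m, j, ha, hb, hc, hc2, hm, hm'⟩ := exists_eisenstein_invariants hK hσ hq hP hPq hin
  have h4 : q ≠ 3 → ¬ (q : ℤ) ^ 4 ∣ m ^ 2 := fun h3 ↦ by
    rw [hm']
    refine not_pow_four_dvd_cubic_discr (Nat.prime_iff_prime_int.mp hq) (fun h ↦ h3 ?_) ha hb hc hc2
    exact (Nat.prime_dvd_prime_iff_eq hq Nat.prime_three).mp (by exact_mod_cast h)
  have h6 : q = 3 → ¬ (q : ℤ) ^ 6 ∣ m ^ 2 := by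
    rintro rfl
    rw [hm']
    exact not_three_pow_six_dvd_cubic_discr ha hb hc hc2
  refine ⟨m, j, hm, ?_, h4, h6⟩
  rintro rfl
  by_cases h : q = 3
  · exact h6 h (by simp)
  · exact h4 h (by simp)

theorem exists_discr_eq_sq (hK : finrank ℚ K = 3) (hσ : σ ≠ 1) (hq : q.Prime)
    (hP : P.IsPrime) (hPq : Ideal.span {(q : 𝓞 K)} = P ^ 3) (hin : ∀ x : 𝓞 K, σ • x - x ∈ P) :
    ∃ k : ℕ, discr K = k ^ 2 := by
  obtain ⟨m, j, hm, hm0, -⟩ := pow_not_dvd_of_eisenstein hK hσ hq hP hPq hin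
  obtain ⟨l, rfl⟩ : j ∣ m := (Int.pow_dvd_pow_iff two_ne_zero).mp ⟨_, hm⟩
  have hj : j ≠ 0 := left_ne_zero_of_mul hm0
  refine ⟨l.natAbs, ?_⟩
  rw [Int.natCast_natAbs, sq_abs]
  exact mul_left_cancel₀ (pow_ne_zero 2 hj) (by rw [← hm]; ring)

/-- As `σ` acts trivially modulo `P`, every trace is `≡ 3x ≡ 0 mod P`, hence divisible by `3`. The
whole 3×3 trace matrix is then divisible by `3`. -/
theorem three_pow_three_dvd_discr (hK : finrank ℚ K = 3) (hσ : σ ≠ 1)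
    (hP : P.IsPrime) (hP3 : (3 : 𝓞 K) ∈ P) (hin : ∀ x : 𝓞 K, σ • x - x ∈ P) :
    3 ^ 3 ∣ discr K := by
  have htr : ∀ x : 𝓞 K, 3 ∣ Algebra.trace ℤ (𝓞 K) x := fun x ↦ by
    refine natCast_dvd_of_intCast_mem Nat.prime_three hP.ne_top (P := P) (by exact_mod_cast hP3) ?_
    have : ((Algebra.trace ℤ (𝓞 K) x : ℤ) : 𝓞 K) =
        3 * x + 2 * (σ • x - x) + (σ • σ • x - σ • x) := by
      rw [coe_trace_eq_add_add hK hσ]; ring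
    rw [this]
    exact add_mem (add_mem (P.mul_mem_right _ hP3) (P.mul_mem_left _ (hin x))) (hin _)
  choose f hf using htr
  have hM : Algebra.traceMatrix ℤ (RingOfIntegers.basis K) = (3 : ℤ) • Matrix.of fun i j ↦
      f (RingOfIntegers.basis K i * RingOfIntegers.basis K j) := by
    ext i j
    simp [Algebra.traceMatrix_apply, Algebra.traceForm_apply, hf]
  rw [← discr_eq_discr K (RingOfIntegers.basis K), Algebra.discr_def, hM, Matrix.det_smul,
    ← finrank_eq_card_chooseBasisIndex, RingOfIntegers.rank, hK]
  exact dvd_mul_right _ _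

/-- Upper bounds come from the Eisenstein-type invariants. Lower bounds come from ramification, and
for `q = 3` from `27 ∣ k²`, which gives exponent at least `3/2`, so at least `2`. -/
theorem factorization_sqrt_discr (hK : finrank ℚ K = 3) (hσ : σ ≠ 1) (hq : q.Prime)
    (hP : P.IsPrime) (hPq : Ideal.span {(q : 𝓞 K)} = P ^ 3) (hin : ∀ x : 𝓞 K, σ • x - x ∈ P)
    {k : ℕ} (hk : discr K = k ^ 2) : k.factorization q = if q = 3 then 2 else 1 := by
  obtain ⟨m, j, hm, -, h4, h6⟩ := pow_not_dvd_of_eisenstein hK hσ hq hP hPq hin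
  have hk0 : k ≠ 0 := fun h ↦ discr_ne_zero K (by simp [hk, h])
  have hqP : (q : 𝓞 K) ∈ P := Ideal.pow_le_self three_ne_zero (hPq ▸ Ideal.mem_span_singleton_self _)
  have hP0 : P ≠ ⊥ := by
    rintro rfl
    exact hq.ne_zero (by exact_mod_cast Ideal.mem_bot.mp hqP)
  have hdvd : ∀ e : ℕ, q ^ e ∣ k → (q : ℤ) ^ (e * 2) ∣ m ^ 2 := fun e he ↦ by
    rw [hm, hk, pow_mul]
    exact dvd_mul_of_dvd_right (pow_dvd_pow_of_dvd (by exact_mod_cast he) 2) _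
  have hiff := fun e ↦ (hq.pow_dvd_iff_le_factorization hk0 (k := e))
  split_ifs with h3
  · subst h3
    have h27 : 3 ^ 3 ∣ k ^ 2 := by
      have := three_pow_three_dvd_discr hK hσ hP (by exact_mod_cast hqP) hin
      rw [hk] at this
      exact_mod_cast this
    have hle := (hq.pow_dvd_iff_le_factorization (pow_ne_zero 2 hk0)).mp h27
    rw [Nat.factorization_pow, Finsupp.smul_apply, smul_eq_mul] at hle
    have hlt : ¬ 3 ≤ k.factorization 3 := fun h ↦ h6 rfl (hdvd 3 ((hiff 3).mpr h))
    omega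
  · have h1 : (q : ℤ) ∣ discr K := dvd_discr_of_sq_dvd hq (Ideal.prime_of_isPrime hP0 hP)
      (hPq ▸ pow_dvd_pow P (by norm_num))
    rw [hk] at h1
    have h1 : q ^ 1 ∣ k := by
      rw [pow_one]
      exact hq.dvd_of_dvd_pow (by exact_mod_cast h1)
    have hle := (hiff 1).mp h1
    have hlt : ¬ 2 ≤ k.factorization q := fun h ↦ h4 h3 (hdvd 2 ((hiff 2).mpr h))
    omega

end TotallyRamified

/-! ### Inertia in cyclotomic fields. -/

section Cyclotomic

theorem dvd_of_dvd_discr_of_cyclotomic (K Z : Type*) [Field K] [NumberField K] [Field Z]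
    [NumberField Z] [Algebra K Z] {p : ℕ} [NeZero p] [IsCyclotomicExtension {p} ℚ Z] {q : ℕ}
    (hq : q.Prime) (hqK : (q : ℤ) ∣ discr K) : q ∣ p := by
  have h := Int.natCast_dvd.mp (hqK.trans (discr_dvd_discr K Z))
  rw [IsCyclotomicExtension.Rat.natAbs_discr p Z] at h
  exact hq.dvd_of_dvd_pow (h.trans
    (Nat.div_dvd_of_dvd (Nat.prod_primeFactors_pow_totient_ediv_dvd (NeZero.pos p))))

variable {K Z : Type*} [Field K] [NumberField K] [IsGalois ℚ K] [Field Z] [NumberField Z]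
  [Algebra K Z] {p : ℕ} [NeZero p] [IsCyclotomicExtension {p} ℚ Z] {q r : ℕ}

/-- If `K ⊆ Z = ℚ(ζ_p)` does not embed into `ℚ(ζ_r)`, where `r` divides `p`, then some automorphism
of `Z` fixes the `r`-th roots of unity but not `K`. -/
theorem exists_restrictNormal_ne_one (hr : r ∣ p) (hK : IsEmpty (K →ₐ[ℚ] CyclotomicField r ℚ)) :
    ∃ σ : Gal(Z/ℚ), (∀ y : Z, y ^ r = 1 → σ y = y) ∧ σ.restrictNormal K ≠ 1 := by
  have : IsGalois ℚ Z := IsCyclotomicExtension.isGalois {p} ℚ Z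
  have hr0 : NeZero r := ⟨fun h ↦ NeZero.ne p (Nat.eq_zero_of_zero_dvd (h ▸ hr))⟩
  obtain ⟨n, hn⟩ := hr
  have hζ := IsCyclotomicExtension.zeta_spec p ℚ Z
  set ζ := IsCyclotomicExtension.zeta p ℚ Z
  have hζr : IsPrimitiveRoot (ζ ^ n) r := hζ.pow (NeZero.pos p) (by rw [hn, mul_comm])
  let E := IntermediateField.adjoin ℚ {ζ ^ n}
  have hE : IsCyclotomicExtension {r} ℚ E :=
    (IntermediateField.isCyclotomicExtension_singleton_iff_eq_adjoin _ _ _ _ hζr).mpr rfl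
  have : NeZero (r : ℚ) := ⟨by exact_mod_cast hr0.out⟩
  by_contra! H
  let φ : K →ₐ[ℚ] Z := IsScalarTower.toAlgHom ℚ K Z
  -- Galois correspondence: if every automorphism fixing `E = ℚ(ζ_r)` also fixes `K`, then `K ⊆ E`.
  have hle : φ.fieldRange ≤ E := by
    rw [← IsGalois.fixedField_fixingSubgroup E, IntermediateField.le_iff_le]
    intro σ hσ
    rw [IntermediateField.mem_fixingSubgroup_iff] at hσ ⊢
    have hσr := H σ fun y hy ↦ hσ y (by
      obtain ⟨i, -, rfl⟩ := hζr.eq_pow_of_pow_eq_one hy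
      exact pow_mem (IntermediateField.mem_adjoin_simple_self ℚ _) i)
    rintro _ ⟨x, rfl⟩
    have := AlgEquiv.restrictNormal_commutes σ K x
    rw [hσr] at this
    exact this.symm
  have : IsCyclotomicExtension {r} ℚ (CyclotomicField r ℚ) := CyclotomicField.isCyclotomicExtension r ℚ
  exact hK.false (((IsCyclotomicExtension.algEquiv {r} ℚ E (CyclotomicField r ℚ)).toAlgHom.comp
    (IntermediateField.inclusion hle)).comp φ.rangeRestrict)

/-- Automorphisms of `ℚ(ζ_p)` fixing the prime-to-`q` roots of unity are in the inertia groups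
above `q`. -/
theorem smul_sub_mem_of_fixes (hq : q.Prime) {k m : ℕ} (hp : p = q ^ k * m) {σ : Gal(Z/ℚ)}
    (hσ : ∀ y : Z, y ^ m = 1 → σ y = y) {P : Ideal (𝓞 Z)} (hP : P.IsPrime)
    (hqP : (q : 𝓞 Z) ∈ P) (x : 𝓞 Z) : σ • x - x ∈ P := by
  have hζ := IsCyclotomicExtension.zeta_spec p ℚ Z
  have hx : x ∈ Algebra.adjoin ℤ {hζ.toInteger} := by
    rw [IsCyclotomicExtension.Rat.adjoin_singleton_eq_top hζ]
    trivial
  induction hx using Algebra.adjoin_induction with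
  | mem x hx =>
    obtain rfl := Set.mem_singleton_iff.mp hx
    -- `ζ^(q^k)` is an `m`-th root of unity, so `σ` fixes it. Modulo `P` the `q^k`-power map is
    -- additive and has no nonzero kernel, whence `σζ ≡ ζ`.
    have hpow : (σ • hζ.toInteger) ^ q ^ k = hζ.toInteger ^ q ^ k := by
      rw [← smul_pow']
      ext
      refine hσ _ ?_
      change (IsCyclotomicExtension.zeta p ℚ Z ^ q ^ k) ^ m = 1
      rw [← pow_mul, ← hp]
      exact hζ.pow_eq_one
    have hq0 : (q : 𝓞 Z ⧸ P) = 0 := by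
      rw [← map_natCast (Ideal.Quotient.mk P)]
      exact Ideal.Quotient.eq_zero_iff_mem.mpr hqP
    have : Fact q.Prime := ⟨hq⟩
    have : CharP (𝓞 Z ⧸ P) q :=
      ringChar.of_eq (CharP.ringChar_of_prime_eq_zero hq hq0)
    rw [← Ideal.Quotient.eq_zero_iff_mem]
    refine eq_zero_of_pow_eq_zero (n := q ^ k) ?_
    rw [map_sub, sub_pow_char_pow, ← map_pow, ← map_pow, hpow, sub_self]
  | algebraMap n =>
    have : σ • algebraMap ℤ (𝓞 Z) n = algebraMap ℤ (𝓞 Z) n := by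
      ext
      exact map_intCast σ n
    rw [this, sub_self]
    exact P.zero_mem
  | add x y _ _ hx hy =>
    rw [smul_add, add_sub_add_comm]
    exact add_mem hx hy
  | mul x y _ _ hx hy =>
    have : σ • (x * y) - x * y = (σ • x - x) * σ • y + x * (σ • y - y) := by
      rw [smul_mul']; ring
    rw [this]
    exact add_mem (P.mul_mem_right _ hx) (P.mul_mem_left _ hy)

/-- For `m` the prime-to-`q` part of `p`, minimality of `p` keeps `K` out of `ℚ(ζ_m)`. An
automorphism fixing the `m`-th roots of unity but not `K` is inertial above `q`. -/
theorem exists_inertia (K Z : Type*) [Field K] [NumberField K] [IsGalois ℚ K] [Field Z]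
    [NumberField Z] [Algebra K Z] {p : ℕ} [NeZero p] [IsCyclotomicExtension {p} ℚ Z] {q : ℕ}
    (hq : q.Prime) (hqp : q ∣ p)
    (hK : ∀ r, 0 < r → r < p → IsEmpty (K →ₐ[ℚ] CyclotomicField r ℚ)) :
    ∃ (P : Ideal (𝓞 K)) (σ : Gal(K/ℚ)), P.IsPrime ∧ (q : 𝓞 K) ∈ P ∧ σ ≠ 1 ∧
      ∀ x : 𝓞 K, σ • x - x ∈ P := by
  obtain ⟨k, m, hqm, hp⟩ := Nat.exists_eq_pow_mul_and_not_dvd (NeZero.ne p) q hq.ne_one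
  have hm : 0 < m := Nat.pos_of_ne_zero fun h ↦ hqm (h ▸ dvd_zero q)
  have hmp : m < p := lt_of_le_of_ne (Nat.le_of_dvd (NeZero.pos p) (hp ▸ dvd_mul_left m _))
    fun h ↦ hqm (h ▸ hqp)
  obtain ⟨σ, hσ, hσK⟩ := exists_restrictNormal_ne_one (Z := Z) (hp ▸ dvd_mul_left m _) (hK m hm hmp)
  have : Fact q.Prime := ⟨hq⟩
  have hmax : (Ideal.span {(q : ℤ)}).IsMaximal := Int.ideal_span_isMaximal_of_prime q
  obtain ⟨P, hPmax, hP⟩ := Ideal.exists_maximal_ideal_liesOver_of_isIntegral (S := 𝓞 Z)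
    (Ideal.span {(q : ℤ)})
  have hqP : (q : 𝓞 Z) ∈ P := by
    exact_mod_cast (Ideal.liesOver_span_iff hPmax.ne_top (Nat.prime_iff_prime_int.mp hq)).mp hP
  refine ⟨P.comap (algebraMap (𝓞 K) (𝓞 Z)), σ.restrictNormal K, hPmax.isPrime.comap _, ?_, hσK,
    fun x ↦ ?_⟩
  · rw [Ideal.mem_comap, map_natCast]
    exact hqP
  · have hx : algebraMap (𝓞 K) (𝓞 Z) (σ.restrictNormal K • x) = σ • algebraMap (𝓞 K) (𝓞 Z) x := by
      ext
      exact AlgEquiv.restrictNormal_commutes σ K x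
    rw [Ideal.mem_comap, map_sub, hx]
    exact smul_sub_mem_of_fixes hq hp hσ hPmax.isPrime hqP _

theorem galEquivZMod_eq_one_add {r n : ℕ} (hp : p = r * n) {σ : Gal(Z/ℚ)}
    (hσ : ∀ y : Z, y ^ r = 1 → σ y = y) :
    ∃ v : ℤ, ((IsCyclotomicExtension.Rat.galEquivZMod p Z σ : (ZMod p)ˣ) : ZMod p) =
      ((1 + r * v : ℤ) : ZMod p) := by
  have hζ := IsCyclotomicExtension.zeta_spec p ℚ Z
  set ζ := IsCyclotomicExtension.zeta p ℚ Z
  have hζr : IsPrimitiveRoot (ζ ^ n) r := hζ.pow (NeZero.pos p) (by rw [hp, mul_comm])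
  have h1 := hσ _ hζr.pow_eq_one
  have hr0 : NeZero r := ⟨fun h ↦ NeZero.ne p (by rw [hp, h, zero_mul])⟩
  rw [IsCyclotomicExtension.Rat.galEquivZMod_apply_of_pow_eq p Z σ
    (by rw [← pow_mul, mul_comm, pow_mul, hζ.pow_eq_one, one_pow])] at h1
  set u := (IsCyclotomicExtension.Rat.galEquivZMod p Z σ).val
  have h2 : u.val ≡ 1 [MOD r] := by
    have : (ζ ^ n) ^ u.val = (ζ ^ n) ^ 1 := by rw [h1, pow_one]
    rwa [(hζr.isOfFinOrder (NeZero.ne _)).pow_inj_mod, ← hζr.eq_orderOf] at this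
  obtain ⟨v, hv⟩ := (Nat.modEq_iff_dvd.mp h2.symm)
  refine ⟨v, ?_⟩
  have : (1 + r * v : ℤ) = (u.val : ℤ) := by push_cast at hv; linarith
  rw [this]
  simp

end Cyclotomic

/-! ### Prime exponents in the conductor. -/

section ConductorShape

theorem eq_one_of_pow_eq_one_of_coprime_three {G : Type*} [Group G] (hG : Nat.card G = 3) {g : G}
    {n : ℕ} (hn : n.Coprime 3) (hg : g ^ n = 1) : g = 1 := by
  have h3 : g ^ 3 = 1 := hG ▸ pow_card_eq_one'
  have := orderOf_dvd_of_pow_eq_one hg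
  have := orderOf_dvd_of_pow_eq_one h3
  exact orderOf_eq_one_iff.mp (Nat.eq_one_of_dvd_coprimes hn ‹_› ‹_›)

theorem mul_dvd_one_add_mul_pow_sub_one {q r v : ℤ} {n : ℕ} (hq : q = n) (hqr : q ∣ r) :
    r * q ∣ (1 + r * v) ^ n - 1 := by
  obtain ⟨k, hk⟩ := Polynomial.powAddExpansion (1 : ℤ) (r * v) n
  obtain ⟨w, rfl⟩ := hqr
  rw [hk]
  exact ⟨v + w * v ^ 2 * k, by simp [← hq]; ring⟩

variable {K Z : Type*} [Field K] [NumberField K] [IsGalois ℚ K] [Field Z] [NumberField Z]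
  [Algebra K Z] {p : ℕ} [NeZero p] [IsCyclotomicExtension {p} ℚ Z] {q r : ℕ} {σ : Gal(Z/ℚ)}

theorem restrictNormal_eq_one_of_pow_dvd (hK : Nat.card Gal(K/ℚ) = 3) {n : ℕ} (hn : n.Coprime 3)
    {v : ℤ} (hσ : ((IsCyclotomicExtension.Rat.galEquivZMod p Z σ : (ZMod p)ˣ) : ZMod p) = (v : ZMod p))
    (hv : (p : ℤ) ∣ v ^ n - 1) : σ.restrictNormal K = 1 := by
  have h1 : σ ^ n = 1 := by
    apply (IsCyclotomicExtension.Rat.galEquivZMod p Z).injective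
    rw [map_pow, map_one]
    ext
    rw [Units.val_pow_eq_pow_val, hσ, Units.val_one]
    have := (ZMod.intCast_zmod_eq_zero_iff_dvd _ p).mpr hv
    push_cast at this
    exact sub_eq_zero.mp this
  apply eq_one_of_pow_eq_one_of_coprime_three hK hn
  have := congrArg (AlgEquiv.restrictNormalHom K) h1
  rwa [map_pow, map_one] at this

theorem restrictNormal_eq_one_of_cube (hK : Nat.card Gal(K/ℚ) = 3)
    {v w : ℤ} (hσ : ((IsCyclotomicExtension.Rat.galEquivZMod p Z σ : (ZMod p)ˣ) : ZMod p) = (v : ZMod p))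
    (hv : (p : ℤ) ∣ w ^ 3 - v) : σ.restrictNormal K = 1 := by
  have h0 : (w : ZMod p) ^ 3 = v := by
    have := (ZMod.intCast_zmod_eq_zero_iff_dvd _ p).mpr hv
    push_cast at this
    exact sub_eq_zero.mp this
  have hw : IsUnit (w : ZMod p) := by
    refine (isUnit_pow_iff three_ne_zero).mp ?_
    rw [h0, ← hσ]
    exact Units.isUnit _
  obtain ⟨w', hw'⟩ := hw
  obtain ⟨τ, hτ⟩ := (IsCyclotomicExtension.Rat.galEquivZMod p Z).surjective w'
  have h1 : σ = τ ^ 3 := by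
    apply (IsCyclotomicExtension.Rat.galEquivZMod p Z).injective
    rw [map_pow, hτ]
    ext
    rw [Units.val_pow_eq_pow_val, hσ, hw', h0]
  have h2 : σ.restrictNormal K = (τ.restrictNormal K) ^ 3 := by
    have := congrArg (AlgEquiv.restrictNormalHom K) h1
    rwa [map_pow] at this
  rw [h2, ← hK]
  exact pow_card_eq_one'

/-- With `r = p/q`, some `σ ↔ 1 + rv` in `(ℤ/p)ˣ` acts nontrivially on `K`. Each excluded exponent
makes `σ` a cube or of order prime to `3`, hence trivial on a field with Galois group of order `3`.
-/
theorem factorization_conductor (K Z : Type*) [Field K] [NumberField K] [IsGalois ℚ K] [Field Z]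
    [NumberField Z] [Algebra K Z] {p : ℕ} [NeZero p] [IsCyclotomicExtension {p} ℚ Z]
    (hG : Nat.card Gal(K/ℚ) = 3) {q : ℕ} (hq : q.Prime) (hqp : q ∣ p)
    (hK : ∀ r, 0 < r → r < p → IsEmpty (K →ₐ[ℚ] CyclotomicField r ℚ)) :
    q ≠ 2 ∧ p.factorization q = if q = 3 then 2 else 1 := by
  obtain ⟨r, hp⟩ := hqp
  have hr : 0 < r := Nat.pos_of_ne_zero fun h ↦ NeZero.ne p (by rw [hp, h, mul_zero])
  have hrp : r < p := by rw [hp]; exact lt_mul_of_one_lt_left hr hq.one_lt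
  have hp' : p = r * q := by rw [hp, mul_comm]
  obtain ⟨σ, hσ, hσK⟩ := exists_restrictNormal_ne_one (Z := Z) ⟨q, hp'⟩ (hK r hr hrp)
  obtain ⟨v, hv⟩ := galEquivZMod_eq_one_add hp' hσ
  have hpZ : (p : ℤ) = r * q := by rw [hp]; push_cast; ring
  have h1 : q ∣ r → q = 3 := fun hqr ↦ by
    by_contra h3
    refine hσK (restrictNormal_eq_one_of_pow_dvd hG ((Nat.coprime_primes hq Nat.prime_three).mpr h3) hv ?_)
    rw [hpZ]
    exact mul_dvd_one_add_mul_pow_sub_one rfl (by exact_mod_cast hqr)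
  have h2 : ¬ 9 ∣ r ∨ q ≠ 3 := by
    by_contra! h
    obtain ⟨⟨l, rfl⟩, rfl⟩ := h
    -- Here `r = 9l` and `p = 27l`, and `(1 + 3lv)³ ≡ 1 + 9lv mod 27l`.
    refine hσK (restrictNormal_eq_one_of_cube (w := 1 + 3 * l * v) hG hv ?_)
    rw [hpZ]
    push_cast
    exact ⟨l * v ^ 2 + l ^ 2 * v ^ 3, by ring⟩
  have h3 : ¬ q ∣ r → q ≠ 2 ∧ q ≠ 3 := fun hqr ↦ by
    by_contra h
    have hu : ¬ (q : ℤ) ∣ 1 + r * v := fun hdvd ↦ by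
      have hunit := (IsCyclotomicExtension.Rat.galEquivZMod p Z σ).isUnit
      rw [hv, ZMod.coe_int_isUnit_iff_isCoprime] at hunit
      exact (Nat.prime_iff_prime_int.mp hq).not_isUnit
        (hunit.isUnit_of_dvd' ⟨r, by rw [hpZ]; ring⟩ hdvd)
    -- Units modulo `2` or `3` square to `1`; as `1 + rv ≡ 1 mod r` too, `σ² = 1`.
    have hqu : (q : ℤ) ∣ (1 + r * v) ^ 2 - 1 := by
      generalize (1 + r * v : ℤ) = u at hu
      rw [show u ^ 2 - 1 = (u - 1) * (u + 1) by ring]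
      obtain rfl | rfl : q = 2 ∨ q = 3 := by tauto
      · exact Dvd.dvd.mul_right (by push_cast at hu ⊢; omega) _
      · push_cast at hu ⊢
        obtain h | h : (3 : ℤ) ∣ u - 1 ∨ (3 : ℤ) ∣ u + 1 := by omega
        · exact h.mul_right _
        · exact h.mul_left _
    refine hσK (restrictNormal_eq_one_of_pow_dvd hG (n := 2) (by norm_num) hv ?_)
    rw [hpZ]
    refine IsCoprime.mul_dvd (Nat.isCoprime_iff_coprime.mpr ?_) ⟨2 * v + r * v ^ 2, by ring⟩ hqu
    exact ((Nat.Prime.coprime_iff_not_dvd hq).mpr hqr).symm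
  have hfac : p.factorization q = 1 + r.factorization q := by
    rw [hp, Nat.factorization_mul hq.ne_zero hr.ne', Finsupp.add_apply, hq.factorization_self]
  by_cases hqr : q ∣ r
  · obtain rfl := h1 hqr
    have h9 : r.factorization 3 < 2 := by
      refine lt_of_not_ge fun h ↦ ?_
      have := (hq.pow_dvd_iff_le_factorization hr.ne').mpr h
      norm_num at this h2
      exact h2 this
    have := hq.factorization_pos_of_dvd hr.ne' hqr
    rw [hfac]
    refine ⟨by norm_num, ?_⟩
    rw [if_pos rfl]
    omega
  · obtain ⟨hq2, hq3⟩ := h3 hqr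
    rw [hfac, if_neg hq3, Nat.factorization_eq_zero_of_not_dvd hqr]
    exact ⟨hq2, rfl⟩

end ConductorShape

/-! ### The discriminant of the cubic field and the ideal `I`. -/

section Conductor

/-- A Galois cubic field of conductor `p` has discriminant `p ^ 2`. -/
theorem discr_eq_sq_of_conductor (K Z : Type*) [Field K] [NumberField K] [IsGalois ℚ K] [Field Z]
    [NumberField Z] [Algebra K Z] {p : ℕ} [NeZero p] [IsCyclotomicExtension {p} ℚ Z]
    (hK : finrank ℚ K = 3)
    (hp : ∀ r, 0 < r → r < p → IsEmpty (K →ₐ[ℚ] CyclotomicField r ℚ)) :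
    discr K = (p : ℤ) ^ 2 := by
  have hG := card_gal_eq_three hK
  -- Minkowski's bound supplies one ramified prime, which is enough to see that `Δ_K` is a perfect
  -- square.
  have hdisc : 2 < |discr K| := abs_discr_gt_two (by rw [hK]; norm_num)
  obtain ⟨q, hq, hqK⟩ := Nat.exists_prime_and_dvd (n := (discr K).natAbs) (by
    rw [Int.abs_eq_natAbs] at hdisc
    omega)
  obtain ⟨P, σ, hP, hqP, hσ, hin⟩ := exists_inertia K Z hq
    (dvd_of_dvd_discr_of_cyclotomic K Z hq (Int.natCast_dvd.mpr hqK)) hp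
  obtain ⟨k, hk⟩ := exists_discr_eq_sq hK hσ hq hP
    (span_natCast_eq_pow_three hK hσ hq hP hqP hin) hin
  have hk0 : k ≠ 0 := by
    rintro rfl
    exact discr_ne_zero K (by simpa using hk)
  suffices k = p by rw [hk, this]
  refine Nat.eq_of_factorization_eq hk0 (NeZero.ne p) fun q ↦ ?_
  by_cases hq : q.Prime
  · by_cases hqp : q ∣ p
    · obtain ⟨P, σ, hP, hqP, hσ, hin⟩ := exists_inertia K Z hq hqp hp
      rw [factorization_sqrt_discr hK hσ hq hP
        (span_natCast_eq_pow_three hK hσ hq hP hqP hin) hin hk,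
        (factorization_conductor K Z hG hq hqp hp).2]
    · rw [Nat.factorization_eq_zero_of_not_dvd hqp]
      refine Nat.factorization_eq_zero_of_not_dvd fun h ↦ hqp ?_
      refine dvd_of_dvd_discr_of_cyclotomic K Z hq ?_
      rw [hk, sq]
      exact Dvd.dvd.mul_right (by exact_mod_cast h) _
  · simp [Nat.factorization_eq_zero_of_not_prime _ hq]

theorem absNorm_eq_of_pow_three_eq_span {K : Type*} [Field K] [NumberField K]
    (hK : finrank ℚ K = 3) {I : Ideal (𝓞 K)} {t : ℕ}
    (hI : I ^ 3 = Ideal.span {(t : 𝓞 K)}) : Ideal.absNorm I = t := by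
  have h := congrArg Ideal.absNorm hI
  rw [map_pow, Ideal.absNorm_span_singleton, ← map_natCast (algebraMap ℤ (𝓞 K)),
    Algebra.norm_algebraMap, RingOfIntegers.rank, hK, Int.natAbs_pow] at h
  exact Nat.pow_left_injective three_ne_zero (by simpa using h)

/-- `I` is the product of the primes above the `q ∣ t`; they are pairwise comaximal because they
contain distinct rational primes. -/
theorem exists_ideal_pow_three_eq_span {K : Type*} [Field K] [NumberField K] {t : ℕ}
    (ht : Squarefree t)
    (h : ∀ q : ℕ, q.Prime → q ∣ t →
      ∃ P : Ideal (𝓞 K), P.IsPrime ∧ Ideal.span {(q : 𝓞 K)} = P ^ 3) :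
    ∃ I : Ideal (𝓞 K), Squarefree I ∧ I ^ 3 = Ideal.span {(t : 𝓞 K)} := by
  have h' : ∀ q : ℕ, ∃ P : Ideal (𝓞 K), q ∈ t.primeFactors →
      P.IsPrime ∧ Ideal.span {(q : 𝓞 K)} = P ^ 3 := fun q ↦ by
    by_cases hq : q ∈ t.primeFactors
    · obtain ⟨P, hP⟩ := h q (Nat.prime_of_mem_primeFactors hq) (Nat.dvd_of_mem_primeFactors hq)
      exact ⟨P, fun _ ↦ hP⟩
    · exact ⟨⊥, fun h ↦ absurd h hq⟩
  choose P hP using h'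
  have hmem : ∀ q ∈ t.primeFactors, (q : 𝓞 K) ∈ P q := fun q hq ↦
    Ideal.pow_le_self three_ne_zero
      ((hP q hq).2 ▸ Ideal.mem_span_singleton_self _ : (q : 𝓞 K) ∈ P q ^ 3)
  have hne : ∀ q ∈ t.primeFactors, P q ≠ ⊥ := fun q hq h0 ↦ by
    have := hmem q hq
    rw [h0, Ideal.mem_bot] at this
    exact (Nat.prime_of_mem_primeFactors hq).ne_zero (by exact_mod_cast this)
  refine ⟨∏ q ∈ t.primeFactors, P q, ?_, ?_⟩
  · refine Finset.squarefree_prod_of_pairwise_isCoprime ?_ fun q hq ↦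
      (Ideal.prime_of_isPrime (hne q hq) (hP q hq).1).irreducible.squarefree
    intro q hq r hr hqr
    simp only [Function.onFun]
    refine (Ideal.isCoprime_iff_add.mpr ?_).isRelPrime
    rw [Ideal.add_eq_sup, Ideal.one_eq_top]
    by_contra htop
    exact not_coprime_of_natCast_mem htop (Ideal.mem_sup_left (hmem q hq))
      (Ideal.mem_sup_right (hmem r hr)) ((Nat.coprime_primes (Nat.prime_of_mem_primeFactors hq)
        (Nat.prime_of_mem_primeFactors hr)).mpr hqr)
  · rw [← Finset.prod_pow, Finset.prod_congr rfl fun q hq ↦ (hP q hq).2.symm,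
      Ideal.prod_span_singleton, ← Nat.cast_prod, Nat.prod_primeFactors_of_squarefree ht]

/-- A quadratic irrationality is not contained in a Galois cubic field. -/
theorem sq_ne_neg_natCast_of_finrank_eq_three {K : Type*} [Field K] [NumberField K] [IsGalois ℚ K]
    (hK : finrank ℚ K = 3) {d : ℕ} (hd : d ≠ 0) (s : K) : s ^ 2 ≠ -(d : K) := by
  intro hs
  have hfix : ∀ σ : Gal(K/ℚ), σ s = s := fun σ ↦ by
    have h3 : σ ^ 3 = 1 := card_gal_eq_three hK ▸ pow_card_eq_one'
    have h3' : σ (σ (σ s)) = s := by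
      have := DFunLike.congr_fun h3 s
      simpa [pow_succ] using this
    have h2 : σ s ^ 2 = s ^ 2 := by rw [← map_pow, hs]; simp
    rcases sq_eq_sq_iff_eq_or_eq_neg.mp h2 with h | h
    · exact h
    · rw [h, map_neg, h, neg_neg, h] at h3'
      rw [h, h3']
  obtain ⟨r, rfl⟩ := (IsGalois.mem_range_algebraMap_iff_fixed s).mpr hfix
  have : r ^ 2 = -(d : ℚ) := (algebraMap ℚ K).injective (by simpa using hs)
  have hd' : (0 : ℚ) < d := by exact_mod_cast Nat.pos_of_ne_zero hd
  nlinarith [sq_nonneg r]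

end Conductor

end Auxiliary

/-! ### Assembly of the index and discriminant formulas. -/

theorem lemma3p1 {K F : Type*} [Field K] [NumberField K] [Field F] [NumberField F] [Algebra K F]
    [IsGalois ℚ K] [IsCyclic Gal(K/ℚ)] (hK : Module.finrank ℚ K = 3)
    (p : ℕ) (hp : IsFieldConductor K p)
    (d : ℕ) (hd : Squarefree d)
    (s : F) (hs : s ^ 2 = -(d : F)) (hF : IntermediateField.adjoin K {s} = ⊤) :
    (NumberField.discr F : ℚ) =
        (p : ℚ) ^ 4 * (NumberField.discr (IntermediateField.adjoin ℚ {s}) : ℚ) ^ 3 /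
          (Nat.gcd p d : ℚ) ^ 2 ∧
      (Algebra.adjoin (NumberField.RingOfIntegers K)
        {intDelta d s hs}).toSubring.toAddSubgroup.index = Nat.gcd p d := by
  obtain ⟨⟨hp0, ⟨φ⟩⟩, hmin⟩ := hp
  have : NeZero p := ⟨hp0.ne'⟩
  have hmin' : ∀ r, 0 < r → r < p → IsEmpty (K →ₐ[ℚ] CyclotomicField r ℚ) := fun r hr hrp ↦
    not_nonempty_iff.mp fun h ↦ not_lt_of_ge (hmin ⟨hr, h⟩) hrp
  let Z := CyclotomicField p ℚ
  have : IsCyclotomicExtension {p} ℚ Z := CyclotomicField.isCyclotomicExtension p ℚ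
  let : Algebra K Z := φ.toRingHom.toAlgebra
  have hdisc := discr_eq_sq_of_conductor K Z hK hmin'
  have hG := card_gal_eq_three hK
  have hp2 : ¬ 2 ∣ p := fun h ↦ (factorization_conductor K Z hG Nat.prime_two h hmin').1 rfl
  set t := p.gcd d with ht
  have htd : t ∣ d := Nat.gcd_dvd_right p d
  have htodd : Odd t := by
    rw [← Nat.not_even_iff_odd, even_iff_two_dvd]
    exact fun h ↦ hp2 (h.trans (Nat.gcd_dvd_left p d))
  obtain ⟨m, hm⟩ := htd
  have hsq : Squarefree (t * m) := hm ▸ hd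
  -- A common prime of `m` and `p` would divide `t` as well, so its square would divide `d = tm`.
  have hmp : m.Coprime p := Nat.Coprime.symm <| Nat.coprime_of_dvd fun q hq hqp hqm ↦ by
    have hqt : q ∣ t := Nat.dvd_gcd hqp (hm ▸ hqm.mul_left t)
    exact hq.not_isUnit (hsq q (mul_dvd_mul hqt hqm))
  obtain ⟨I, hI, hIt⟩ := exists_ideal_pow_three_eq_span (K := K) hsq.of_mul_left fun q hq hqt ↦ by
    obtain ⟨P, σ, hP, hqP, hσ, hin⟩ :=
      exists_inertia K Z hq (hqt.trans (Nat.gcd_dvd_left p d)) hmin'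
    exact ⟨P, hP, span_natCast_eq_pow_three hK hσ hq hP hqP hin⟩
  have hIM : Squarefree (I * Ideal.span {(m : NumberField.RingOfIntegers K)}) := by
    refine squarefree_mul_iff.mpr ⟨?_, hI, squarefree_span_natCast hsq.of_mul_right ?_⟩
    · refine IsCoprime.isRelPrime (Ideal.isCoprime_iff_add.mpr ?_)
      rw [Ideal.add_eq_sup, Ideal.one_eq_top]
      by_contra htop
      refine not_coprime_of_natCast_mem (a := t) (b := m) htop (Ideal.mem_sup_left ?_)
        (Ideal.mem_sup_right (Ideal.mem_span_singleton_self _)) (Nat.squarefree_mul_iff.mp hsq).1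
      exact Ideal.pow_le_self three_ne_zero (hIt ▸ Ideal.mem_span_singleton_self _)
    · rw [hdisc]
      exact (Nat.isCoprime_iff_coprime.mpr hmp).pow_right
  have hspan : Ideal.span {(d : NumberField.RingOfIntegers K)} = I ^ 3 * Ideal.span {(m : NumberField.RingOfIntegers K)} := by
    rw [hIt, Ideal.span_singleton_mul_span_singleton, hm, Nat.cast_mul]
  have h2 : IsCoprime 2 (NumberField.discr K) := by
    rw [hdisc]
    exact (Nat.isCoprime_iff_coprime.mpr
      ((Nat.Prime.coprime_iff_not_dvd Nat.prime_two).mpr hp2)).pow_right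
  have hd0 : d ≠ 0 := hd.ne_zero
  have hsK : s ∉ Set.range (algebraMap K F) := by
    rintro ⟨x, rfl⟩
    refine sq_ne_neg_natCast_of_finrank_eq_three hK hd0 x ((algebraMap K F).injective ?_)
    rw [map_pow, hs]
    simp
  obtain ⟨c, hc0, hc1⟩ := exists_basis_quadDelta hs hF hsK
  have hindex := index_adjoin_intDelta hc0 hc1 hs hd (fun _ ↦ two_dvd_of_two_dvd_sq h2)
    (isIntegral_mul_of_isIntegral_sq_mul hspan hIM) hIt htodd ⟨m, hm⟩
  rw [absNorm_eq_of_pow_three_eq_span hK hIt] at hindex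
  refine ⟨?_, hindex⟩
  obtain ⟨τ, n, hτn⟩ := quadDelta_sq hs
  have hmain := discr_mul_index_sq (δ := intDelta d s hs) hc0 hc1 hτn
  rw [hindex, hdisc, hK, ← discr_adjoin_eq hs hd hτn] at hmain
  have ht0 : (t : ℚ) ≠ 0 := by exact_mod_cast hsq.of_mul_left.ne_zero
  rw [eq_div_iff (pow_ne_zero 2 ht0)]
  have := congrArg (Int.cast : ℤ → ℚ) hmain
  push_cast at this
  rw [this]
  ring
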